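/- Let $\Lambda$ be a commutative local uniserial ring of length $n$ (its ideals form a chain and it has length $n$ as a module over itself), let $p$ be a generator of its maximal ideal $\mathfrak m$, and let $k=\Lambda/\mathfrak m$. Let $\mathcal S_2(\Lambda)$ be the category whose objects are the pairs $(B;A)$ consisting of a finitely generated $\Lambda$-module $B$ and a submodule $A\subset B$ with $p^2A=0$, and whose morphisms $(B;A)\to(D;C)$ are the $\Lambda$-linear maps $f:B\to D$ with $f(A)\subset C$. Let $\mathcal P_n$ be the poset consisting of a chain $n-1<\dots<2<1$ and two further points $1',1''$, incomparable to each other and to the points of the chain. Let $\operatorname{rep}_k\mathcal P_n$ be the category of finite dimensional representations of $\mathcal P_n$: an object is a finite dimensional $k$-vector space $V^0$ with subspaces $V^i\subset V^0$ ($i\in\mathcal P_n$) such that $V^i\subset V^j$ whenever $i<j$; a morphism $V\to W$ is a $k$-linear map $h:V^0\to W^0$ with $h(V^i)\subset W^i$ for all $i$. Write $V'=V^{1'}$, $V''=V^{1''}$, and let $\operatorname{rep}'_k\mathcal P_n$ be the full subcategory of the representations with $V^{n-1}\subset V'$ and $V'+V''=V^0$ (if $n=1$, then $V^{n-1}=V^0$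 is the total space). For $(B;A)\in\mathcal S_2(\Lambda)$ put $A^-=\operatorname{rad}A=\mathfrak mA$, $A^+=A+\operatorname{soc}B$ and, for a submodule $C\subset B$, $\widetilde C=((C\cap A^+)+A^-)/A^-\subset A^+/A^-$. Let $F:\mathcal S_2(\Lambda)\to\operatorname{rep}_k\mathcal P_n$ be the additive functor that sends $(B;A)$ to the representation with $V^0=A^+/A^-$, $V^\ell=\widetilde{\operatorname{rad}^\ell B}$ for $1\le\ell\le n-1$, $V'=\widetilde{\operatorname{soc}B}$, $V''=\widetilde A$, and sends a morphism $f:(B;A)\to(D;C)$ to the map $A^+/A^-\to C^+/C^-$ induced by $f$. Let $\mathcal N$ be the categorical ideal of $\mathcal S_2(\Lambda)$ consisting of the morphisms $f:(B;A)\to(D;C)$ with $f(A+\operatorname{soc}B)\subset\operatorname{rad}C$. Then the kernel of $F$ is $\mathcal N$: for every morphism $f$ of $\mathcal S_2(\Lambda)$, $F(f)=0$ if and only if $f\in\mathcal N$. Moreover, $F$ takes its values in $\operatorname{rep}'_k\mathcal P_n$ and induces an additive equivalence of categories $$\bar F:\ \mathcal S_2(\Lambda)/\mathcal N\ \longrightarrow\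 \operatorname{rep}'_k\mathcal P_n .$$ -/

import Mathlib

open CategoryTheory IsLocalRing

universe u

noncomputable section

/-- A commutative ring is *uniserial of length `n`* if its ideals form a chain and it has
length `n` as a module over itself. -/
class IsUniserialOfLength (Λ : Type u) [CommRing Λ] (n : ℕ) : Prop where
  ideal_total : ∀ I J : Ideal Λ, I ≤ J ∨ J ≤ I
  length_eq : Module.length Λ Λ = n

theorem IsUniserialOfLength.isNoetherianRing (Λ : Type u) [CommRing Λ] (n : ℕ)
    [h : IsUniserialOfLength Λ n] : IsNoetherianRing Λ := by
  have h1 : Module.length Λ Λ ≠ ⊤ := by rw [h.length_eq]; exact ENat.natCast_ne_top n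
  exact (isFiniteLength_iff_isNoetherian_isArtinian.mp (Module.length_ne_top_iff.mp h1)).1

/-! ### Radical and socle -/

section RadSoc

variable {Λ : Type u} [CommRing Λ]

/-- The socle of a module: the sum of its simple submodules. -/
def soc (Λ : Type u) [CommRing Λ] (M : Type u) [AddCommGroup M] [Module Λ M] : Submodule Λ M :=
  sSup {S : Submodule Λ M | IsSimpleModule Λ S}

variable {M N : Type u} [AddCommGroup M] [Module Λ M] [AddCommGroup N] [Module Λ N]

theorem soc_le_comap (f : M →ₗ[Λ] N) : soc Λ M ≤ (soc Λ N).comap f := by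
  refine sSup_le fun S hS => ?_
  have hS : IsSimpleModule Λ S := hS
  rw [← Submodule.map_le_iff_le_comap]
  have hr : S.map f = LinearMap.range (f.domRestrict S) := by
    rw [LinearMap.domRestrict, LinearMap.range_comp, Submodule.range_subtype]
  rcases LinearMap.injective_or_eq_zero (f.domRestrict S) with h | h
  · refine le_sSup ?_
    show IsSimpleModule Λ (S.map f)
    rw [hr]
    exact IsSimpleModule.congr (LinearEquiv.ofInjective _ h).symm
  · rw [hr, h, LinearMap.range_zero]
    exact bot_le

variable [IsLocalRing Λ]

/-- The power `rad^ℓ U` of the radical of a submodule `U`, where `rad U = 𝔪 U`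
for the maximal ideal `𝔪` of the local ring `Λ`. -/
def radPow (ℓ : ℕ) (U : Submodule Λ M) : Submodule Λ M :=
  maximalIdeal Λ ^ ℓ • U

/-- The radical `rad U = 𝔪 U` of a submodule. -/
def rad (U : Submodule Λ M) : Submodule Λ M :=
  maximalIdeal Λ • U

theorem radPow_le_comap (ℓ : ℕ) (f : M →ₗ[Λ] N) {U : Submodule Λ M} {W : Submodule Λ N}
    (h : U ≤ W.comap f) : radPow ℓ U ≤ (radPow ℓ W).comap f := by
  rw [← Submodule.map_le_iff_le_comap] at h ⊢
  rw [radPow, Submodule.map_smul'']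
  exact Submodule.smul_mono le_rfl h

theorem rad_le_comap (f : M →ₗ[Λ] N) {U : Submodule Λ M} {W : Submodule Λ N}
    (h : U ≤ W.comap f) : rad U ≤ (rad W).comap f := by
  rw [← Submodule.map_le_iff_le_comap] at h ⊢
  rw [rad, Submodule.map_smul'']
  exact Submodule.smul_mono le_rfl h

theorem rad_le (U : Submodule Λ M) : rad U ≤ U := Submodule.smul_le_right

/-- Over a local ring, `𝔪 M` is the intersection of the maximal submodules of `M`. -/
theorem rad_top_eq_jacobson : rad (⊤ : Submodule Λ M) = Module.jacobson Λ M := by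
  refine le_antisymm ?_ (Module.jacobson_le_of_eq_bot ?_)
  · rw [rad, ← IsLocalRing.ringJacobson_eq_maximalIdeal]
    exact Ring.jacobson_smul_top_le Λ M
  · have ht := Module.isTorsionBySet_quotient_ideal_smul M (maximalIdeal Λ)
    let := ht.module
    let := Ideal.Quotient.field (maximalIdeal Λ)
    have hs : IsSemisimpleModule (Λ ⧸ maximalIdeal Λ) (M ⧸ maximalIdeal Λ • (⊤ : Submodule Λ M)) :=
      inferInstance
    have : IsSemisimpleModule Λ (M ⧸ rad (⊤ : Submodule Λ M)) := ht.isSemisimpleModule_iff.mp hs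
    exact IsSemisimpleModule.jacobson_eq_bot Λ _

theorem smul_eq_zero_of_mem_soc {r : Λ} (hr : r ∈ maximalIdeal Λ) {x : M} (hx : x ∈ soc Λ M) :
    r • x = 0 := by
  suffices h : soc Λ M ≤ LinearMap.ker (LinearMap.lsmul Λ M r) from h hx
  refine sSup_le fun S hS x hxS => ?_
  have hS : IsSimpleModule Λ S := hS
  have h0 : maximalIdeal Λ ≤ Module.annihilator Λ S := by
    have := IsSimpleModule.annihilator_isMaximal (R := Λ) (M := S)
    exact (IsLocalRing.eq_maximalIdeal this).ge
  have := Module.mem_annihilator.mp (h0 hr) ⟨x, hxS⟩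
  simpa using congrArg Subtype.val this

/-- Over a local ring, the socle consists of the elements annihilated by `𝔪`. -/
theorem mem_soc_iff {x : M} : x ∈ soc Λ M ↔ ∀ r ∈ maximalIdeal Λ, r • x = 0 := by
  refine ⟨fun hx r hr => smul_eq_zero_of_mem_soc hr hx, fun hx => ?_⟩
  by_cases h0 : x = 0
  · rw [h0]
    exact Submodule.zero_mem _
  suffices h : IsSimpleModule Λ (Submodule.span Λ {x}) from
    le_sSup (a := Submodule.span Λ {x}) h (Submodule.mem_span_singleton_self x)
  have hk : LinearMap.ker (LinearMap.toSpanSingleton Λ M x) = maximalIdeal Λ := by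
    refine le_antisymm (IsLocalRing.le_maximalIdeal fun h => h0 ?_) fun r hr => hx r hr
    have h1 : (1 : Λ) ∈ LinearMap.ker (LinearMap.toSpanSingleton Λ M x) := h ▸ Submodule.mem_top
    simpa using h1
  have hq : IsSimpleModule Λ (Λ ⧸ LinearMap.ker (LinearMap.toSpanSingleton Λ M x)) := by
    rw [hk, isSimpleModule_iff_isCoatom]
    exact (IsLocalRing.maximalIdeal.isMaximal Λ).out
  rw [← LinearMap.range_toSpanSingleton]
  exact IsSimpleModule.congr (LinearMap.quotKerEquivRange _).symm

end RadSoc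

/-! ### The categories `S(Λ)` and `S_m(Λ)` -/

/-- A pair `(B; A)`: a finitely generated `Λ`-module `B` with a submodule `A`. -/
structure SubPair (Λ : Type u) [CommRing Λ] : Type (u + 1) where
  B : Type u
  [addCommGroup : AddCommGroup B]
  [module : Module Λ B]
  [finite : Module.Finite Λ B]
  A : Submodule Λ B

namespace SubPair

attribute [instance] SubPair.addCommGroup SubPair.module SubPair.finite

variable {Λ : Type u} [CommRing Λ]

/-- A morphism `(B; A) → (D; C)` is a linear map `f : B → D` with `f(A) ⊆ C`. -/
@[ext]
structure Hom (X Y : SubPair Λ) : Type u where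
  lin : X.B →ₗ[Λ] Y.B
  le_comap : X.A ≤ Y.A.comap lin

instance : Category (SubPair Λ) where
  Hom X Y := Hom X Y
  id _ := ⟨LinearMap.id, fun _ h => h⟩
  comp f g := ⟨g.lin ∘ₗ f.lin, fun _ h => g.le_comap (f.le_comap h)⟩

/-- The linear map underlying a morphism of pairs. -/
abbrev linMap {X Y : SubPair Λ} (f : X ⟶ Y) : X.B →ₗ[Λ] Y.B := Hom.lin f

@[ext]
theorem hom_ext {X Y : SubPair Λ} {f g : X ⟶ Y} (h : linMap f = linMap g) : f = g :=
  Hom.ext h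

theorem map_mem {X Y : SubPair Λ} (f : X ⟶ Y) {a : X.B} (ha : a ∈ X.A) : linMap f a ∈ Y.A :=
  Hom.le_comap f ha

/-- The maps `B → D` sending `A` into `C`, as an additive group. -/
def homSubgroup (X Y : SubPair Λ) : AddSubgroup (X.B →ₗ[Λ] Y.B) where
  carrier := {f | X.A ≤ Y.A.comap f}
  add_mem' hf hg _ h := Y.A.add_mem (hf h) (hg h)
  zero_mem' _ _ := Y.A.zero_mem
  neg_mem' hf _ h := Y.A.neg_mem (hf h)

/-- Morphisms of pairs as elements of `homSubgroup`. -/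
def homEquiv (X Y : SubPair Λ) : (X ⟶ Y) ≃ homSubgroup X Y where
  toFun f := ⟨Hom.lin f, Hom.le_comap f⟩
  invFun f := Hom.mk f.1 f.2

instance (X Y : SubPair Λ) : AddCommGroup (X ⟶ Y) := (homEquiv X Y).addCommGroup

@[simp] theorem linMap_id (X : SubPair Λ) : linMap (𝟙 X) = LinearMap.id := rfl
@[simp] theorem linMap_comp {X Y Z : SubPair Λ} (f : X ⟶ Y) (g : Y ⟶ Z) :
    linMap (f ≫ g) = linMap g ∘ₗ linMap f := rfl
@[simp] theorem linMap_add {X Y : SubPair Λ} (f g : X ⟶ Y) :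
    linMap (f + g) = linMap f + linMap g := rfl
@[simp] theorem linMap_zero {X Y : SubPair Λ} : linMap (0 : X ⟶ Y) = 0 := rfl
@[simp] theorem linMap_neg {X Y : SubPair Λ} (f : X ⟶ Y) : linMap (-f) = -linMap f := rfl
@[simp] theorem linMap_sub {X Y : SubPair Λ} (f g : X ⟶ Y) :
    linMap (f - g) = linMap f - linMap g := rfl

instance : Preadditive (SubPair Λ) where
  add_comp _ _ _ f g h := by ext; simp
  comp_add _ _ _ f g h := by ext; simp

/-- The pairs `(B; A)` with `p ^ m A = 0`. -/
def bounded (p : Λ) (m : ℕ) : ObjectProperty (SubPair Λ) :=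
  fun X => ∀ a ∈ X.A, p ^ m • a = 0

section LocalRing

variable [IsLocalRing Λ]

/-- `A⁻ = rad A`. -/
def Aminus (X : SubPair Λ) : Submodule Λ X.B := rad X.A

/-- `A⁺ = A + soc B`. -/
def Aplus (X : SubPair Λ) : Submodule Λ X.B := X.A ⊔ soc Λ X.B

theorem Aminus_le_comap {X Y : SubPair Λ} (f : X ⟶ Y) :
    X.Aminus ≤ Y.Aminus.comap (linMap f) :=
  rad_le_comap _ (Hom.le_comap f)

theorem Aplus_le_comap {X Y : SubPair Λ} (f : X ⟶ Y) : X.Aplus ≤ Y.Aplus.comap (linMap f) :=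
  sup_le (fun _ h => Submodule.mem_sup_left (map_mem f h))
    ((soc_le_comap (linMap f)).trans (Submodule.comap_mono le_sup_right))

theorem Aminus_le_Aplus (X : SubPair Λ) : X.Aminus ≤ X.Aplus :=
  (rad_le X.A).trans le_sup_left

theorem smul_mem_Aminus (X : SubPair Λ) {r : Λ} (hr : r ∈ maximalIdeal Λ) {x : X.B}
    (hx : x ∈ X.Aplus) : r • x ∈ X.Aminus := by
  obtain ⟨a, ha, s, hs, rfl⟩ := Submodule.mem_sup.mp hx
  rw [smul_add, smul_eq_zero_of_mem_soc hr hs, add_zero]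
  exact Submodule.smul_mem_smul hr ha

/-- The total space `A⁺ / A⁻`. -/
def TotalSpace (X : SubPair Λ) : Type u := X.Aplus ⧸ X.Aminus.submoduleOf X.Aplus

instance (X : SubPair Λ) : AddCommGroup X.TotalSpace :=
  inferInstanceAs (AddCommGroup (X.Aplus ⧸ X.Aminus.submoduleOf X.Aplus))

instance (X : SubPair Λ) : Module Λ X.TotalSpace :=
  inferInstanceAs (Module Λ (X.Aplus ⧸ X.Aminus.submoduleOf X.Aplus))

/-- The projection `A⁺ → A⁺ / A⁻`. -/
def proj (X : SubPair Λ) : X.Aplus →ₗ[Λ] X.TotalSpace :=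
  (X.Aminus.submoduleOf X.Aplus).mkQ

theorem proj_surjective (X : SubPair Λ) : Function.Surjective X.proj :=
  Submodule.mkQ_surjective _

theorem proj_eq_zero_iff (X : SubPair Λ) (x : X.Aplus) :
    X.proj x = 0 ↔ (x : X.B) ∈ X.Aminus :=
  Submodule.Quotient.mk_eq_zero _

theorem isTorsionBySet_totalSpace (X : SubPair Λ) :
    Module.IsTorsionBySet Λ X.TotalSpace (maximalIdeal Λ : Set Λ) := by
  rintro x ⟨r, hr⟩
  obtain ⟨y, rfl⟩ := X.proj_surjective x
  show r • X.proj y = 0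
  rw [← map_smul, proj_eq_zero_iff]
  exact X.smul_mem_Aminus hr y.2

/-- `A⁺ / A⁻` is annihilated by `𝔪`, so it is a vector space over `k = Λ / 𝔪`. -/
instance (X : SubPair Λ) : Module (ResidueField Λ) X.TotalSpace :=
  (X.isTorsionBySet_totalSpace.module : Module (Λ ⧸ maximalIdeal Λ) X.TotalSpace)

instance (X : SubPair Λ) : IsScalarTower Λ (ResidueField Λ) X.TotalSpace :=
  ⟨fun r c x => by
    obtain ⟨s, rfl⟩ := Ideal.Quotient.mk_surjective c
    exact mul_smul r s x⟩

/-- The subspace `C~ = ((C ∩ A⁺) + A⁻) / A⁻` of `A⁺ / A⁻`, for a submodule `C` of `B`. -/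
def tilde (X : SubPair Λ) (C : Submodule Λ X.B) : Submodule (ResidueField Λ) X.TotalSpace where
  __ := ((C ⊓ X.Aplus ⊔ X.Aminus).submoduleOf X.Aplus).map X.proj
  smul_mem' c x hx := by
    obtain ⟨r, rfl⟩ := IsLocalRing.residue_surjective c
    have h : residue Λ r • x = r • x := by
      rw [← IsLocalRing.ResidueField.algebraMap_eq, algebraMap_smul]
    rw [h]
    exact Submodule.smul_mem _ r hx

/-- For a morphism `f : (B; A) → (D; C)`, the `Λ`-linear map `A⁺ / A⁻ → C⁺ / C⁻` induced by `f`. -/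
def totalMapAux {X Y : SubPair Λ} (f : X ⟶ Y) : X.TotalSpace →ₗ[Λ] Y.TotalSpace :=
  Submodule.mapQ (X.Aminus.submoduleOf X.Aplus) (Y.Aminus.submoduleOf Y.Aplus)
    ((linMap f).restrict (Aplus_le_comap f)) (fun _ h => Aminus_le_comap f h)

/-- The `k`-linear map `A⁺ / A⁻ → C⁺ / C⁻` induced by a morphism `f : (B; A) → (D; C)`. -/
def totalMap {X Y : SubPair Λ} (f : X ⟶ Y) :
    X.TotalSpace →ₗ[ResidueField Λ] Y.TotalSpace :=
  (totalMapAux f).extendScalarsOfSurjective IsLocalRing.residue_surjective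

@[simp] theorem totalMap_proj {X Y : SubPair Λ} (f : X ⟶ Y) (x : X.Aplus) :
    totalMap f (X.proj x) = Y.proj ⟨linMap f x, Aplus_le_comap f x.2⟩ := rfl

theorem tilde_mono (X : SubPair Λ) {C C' : Submodule Λ X.B} (h : C ≤ C') :
    X.tilde C ≤ X.tilde C' := by
  rintro _ ⟨x, hx, rfl⟩
  exact ⟨x, sup_le_sup_right (inf_le_inf_right _ h) _ hx, rfl⟩

theorem tilde_le_comap {X Y : SubPair Λ} (f : X ⟶ Y) {C : Submodule Λ X.B} {D : Submodule Λ Y.B}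
    (h : C ≤ D.comap (linMap f)) : X.tilde C ≤ (Y.tilde D).comap (totalMap f) := by
  rintro _ ⟨x, hx, rfl⟩
  refine ⟨⟨linMap f x, Aplus_le_comap f x.2⟩, ?_, rfl⟩
  have h' : C ⊓ X.Aplus ⊔ X.Aminus ≤ (D ⊓ Y.Aplus ⊔ Y.Aminus).comap (linMap f) :=
    sup_le (fun y hy => Submodule.mem_sup_left ⟨h hy.1, Aplus_le_comap f hy.2⟩)
      (fun y hy => Submodule.mem_sup_right (Aminus_le_comap f hy))
  exact h' hx

theorem finite_totalSpace (X : SubPair Λ) [IsNoetherianRing Λ] :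
    FiniteDimensional (ResidueField Λ) X.TotalSpace := by
  have : Module.Finite Λ X.TotalSpace := Module.Finite.of_surjective X.proj X.proj_surjective
  exact Module.Finite.of_restrictScalars_finite Λ _ _

end LocalRing

end SubPair

/-! ### Representations of posets -/

/-- A (finite dimensional) `k`-linear representation of a poset `P`: a finite dimensional total
space `V⁰` with subspaces `Vⁱ`, `i ∈ P`, such that `Vⁱ ⊆ Vʲ` whenever `i ≤ j`. -/
structure PosetRep (k : Type u) [Field k] (P : Type) [PartialOrder P] : Type (u + 1) where
  V : Type u
  [addCommGroup : AddCommGroup V]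
  [module : Module k V]
  [finite : FiniteDimensional k V]
  sub : P → Submodule k V
  mono : Monotone sub

namespace PosetRep

attribute [instance] PosetRep.addCommGroup PosetRep.module PosetRep.finite

variable {k : Type u} [Field k] {P : Type} [PartialOrder P]

/-- A morphism of representations is a linear map between the total spaces that respects the
subspaces. -/
@[ext]
structure Hom (V W : PosetRep k P) : Type u where
  lin : V.V →ₗ[k] W.V
  le_comap : ∀ i, V.sub i ≤ (W.sub i).comap lin

instance : Category (PosetRep k P) where
  Hom V W := Hom V W
  id _ := ⟨LinearMap.id, fun _ _ h => h⟩
  comp f g := ⟨g.lin ∘ₗ f.lin, fun i _ h => g.le_comap i (f.le_comap i h)⟩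

/-- The linear map between total spaces underlying a morphism of representations. -/
abbrev linMap {V W : PosetRep k P} (f : V ⟶ W) : V.V →ₗ[k] W.V := Hom.lin f

@[ext]
theorem hom_ext {V W : PosetRep k P} {f g : V ⟶ W} (h : linMap f = linMap g) : f = g :=
  Hom.ext h

/-- The linear maps respecting the subspaces, as an additive group. -/
def homSubgroup (V W : PosetRep k P) : AddSubgroup (V.V →ₗ[k] W.V) where
  carrier := {f | ∀ i, V.sub i ≤ (W.sub i).comap f}
  add_mem' hf hg i _ h := (W.sub i).add_mem (hf i h) (hg i h)
  zero_mem' i _ _ := (W.sub i).zero_mem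
  neg_mem' hf i _ h := (W.sub i).neg_mem (hf i h)

/-- Morphisms of representations as elements of `homSubgroup`. -/
def homEquiv (V W : PosetRep k P) : (V ⟶ W) ≃ homSubgroup V W where
  toFun f := ⟨Hom.lin f, Hom.le_comap f⟩
  invFun f := Hom.mk f.1 f.2

instance (V W : PosetRep k P) : AddCommGroup (V ⟶ W) := (homEquiv V W).addCommGroup

@[simp] theorem linMap_id (V : PosetRep k P) : linMap (𝟙 V) = LinearMap.id := rfl
@[simp] theorem linMap_comp {U V W : PosetRep k P} (f : U ⟶ V) (g : V ⟶ W) :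
    linMap (f ≫ g) = linMap g ∘ₗ linMap f := rfl
@[simp] theorem linMap_add {V W : PosetRep k P} (f g : V ⟶ W) :
    linMap (f + g) = linMap f + linMap g := rfl
@[simp] theorem linMap_zero {V W : PosetRep k P} : linMap (0 : V ⟶ W) = 0 := rfl

instance : Preadditive (PosetRep k P) where
  add_comp _ _ _ f g h := by ext; simp
  comp_add _ _ _ f g h := by ext; simp

end PosetRep

/-! ### The poset `P_n` -/

/-- The points of `P_n`: a chain of points `1, …, n - 1` and two further points `1'` and `1''`. -/
inductive ChainPoset (n : ℕ) : Type
  | chain (ℓ : ℕ) (h₁ : 1 ≤ ℓ) (h₂ : ℓ < n)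
  | prime
  | dprime

namespace ChainPoset

/-- The order on `P_n`: the chain is `n - 1 < ⋯ < 2 < 1`, so that `1` is its largest element,
and each of `1'`, `1''` is comparable only to itself. -/
inductive Le {n : ℕ} : ChainPoset n → ChainPoset n → Prop
  | chain (i j : ℕ) (hi₁ : 1 ≤ i) (hi₂ : i < n) (hj₁ : 1 ≤ j) (hj₂ : j < n) (h : j ≤ i) :
      Le (chain i hi₁ hi₂) (chain j hj₁ hj₂)
  | prime : Le prime prime
  | dprime : Le dprime dprime

instance (n : ℕ) : PartialOrder (ChainPoset n) where
  le := Le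
  le_refl x := by
    cases x with
    | chain ℓ h₁ h₂ => exact .chain _ _ _ _ _ _ le_rfl
    | prime => exact .prime
    | dprime => exact .dprime
  le_trans x y z hxy hyz := by
    cases hxy with
    | chain _ _ _ _ _ _ h =>
      cases hyz with
      | chain _ _ _ _ _ _ h' => exact .chain _ _ _ _ _ _ (h'.trans h)
    | prime => exact hyz
    | dprime => exact hyz
  le_antisymm x y hxy hyx := by
    cases hxy with
    | chain i j _ _ _ _ h =>
      cases hyx with
      | chain _ _ _ _ _ _ h' =>
        obtain rfl := le_antisymm h h'
        rfl
    | prime => rfl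
    | dprime => rfl

end ChainPoset

namespace PosetRep

variable {k : Type u} [Field k] {n : ℕ}

/-- The space `V^ℓ` of a representation of `P_n` for `0 ≤ ℓ ≤ n - 1`: the total space if `ℓ = 0`,
and the subspace at the chain point `ℓ` if `1 ≤ ℓ ≤ n - 1`. -/
def level (V : PosetRep k (ChainPoset n)) (ℓ : ℕ) : Submodule k V.V :=
  if h : 1 ≤ ℓ ∧ ℓ < n then V.sub (.chain ℓ h.1 h.2) else ⊤

/-- The objects of `rep'_k P_n`: the representations `V` with `V^{n-1} ⊆ V'` and
`V' + V'' = V⁰`. -/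
def isAdmissible (k : Type u) [Field k] (n : ℕ) : ObjectProperty (PosetRep k (ChainPoset n)) :=
  fun V => V.level (n - 1) ≤ V.sub .prime ∧ V.sub .prime ⊔ V.sub .dprime = ⊤

end PosetRep

/-! ### The functor `F` -/

section Functor

variable (Λ : Type u) [CommRing Λ] [IsLocalRing Λ] (n : ℕ) [IsUniserialOfLength Λ n]

variable {Λ} in
/-- The submodule of `B` attached to a point of `P_n`: `rad^ℓ B` at `ℓ`, `soc B` at `1'` and
`A` at `1''`. -/
def SubPair.pointSubmodule {n : ℕ} (X : SubPair Λ) : ChainPoset n → Submodule Λ X.B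
  | .chain ℓ _ _ => radPow ℓ ⊤
  | .prime => soc Λ X.B
  | .dprime => X.A

variable {Λ} in
/-- The representation of `P_n` attached to a pair `(B; A)`, with total space `A⁺ / A⁻` and
`V^ℓ = (rad^ℓ B)~`, `V' = (soc B)~`, `V'' = A~`. -/
def SubPair.toRep (X : SubPair Λ) : PosetRep (ResidueField Λ) (ChainPoset n) :=
  haveI := IsUniserialOfLength.isNoetherianRing Λ n
  haveI := X.finite_totalSpace
  { V := X.TotalSpace
    sub := fun i => X.tilde (X.pointSubmodule i)
    mono := fun i j h => by
      cases h with
      | chain i j _ _ _ _ h =>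
        exact X.tilde_mono (Submodule.smul_mono (Ideal.pow_le_pow_right h) le_rfl)
      | prime => exact le_rfl
      | dprime => exact le_rfl }

/-- The functor sending a pair to its representation of `P_n`, and a morphism
`f : (B; A) → (D; C)` to the map `A⁺ / A⁻ → C⁺ / C⁻` induced by `f`. -/
def repFunctor : SubPair Λ ⥤ PosetRep (ResidueField Λ) (ChainPoset n) where
  obj X := X.toRep n
  map f := PosetRep.Hom.mk (SubPair.totalMap f) (fun i => by
    cases i with
    | chain ℓ _ _ => exact SubPair.tilde_le_comap f (radPow_le_comap ℓ _ le_top)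
    | prime => exact SubPair.tilde_le_comap f (soc_le_comap _)
    | dprime => exact SubPair.tilde_le_comap f (SubPair.Hom.le_comap f))
  map_id X := PosetRep.hom_ext (LinearMap.ext fun x => by
    obtain ⟨x, rfl⟩ := X.proj_surjective x
    rfl)
  map_comp {X Y Z} f g := PosetRep.hom_ext (LinearMap.ext fun x => by
    obtain ⟨x, rfl⟩ := X.proj_surjective x
    rfl)

instance : (repFunctor Λ n).Additive where
  map_add {X Y f g} := PosetRep.hom_ext (LinearMap.ext fun x => by
    obtain ⟨x, rfl⟩ := X.proj_surjective x
    rfl)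

variable {Λ}

/-- The category `S_m(Λ)`: the pairs `(B; A)` with `p ^ m A = 0`. -/
abbrev BoundedPair (p : Λ) (m : ℕ) := (SubPair.bounded p m).FullSubcategory

/-- The functor `F : S_2(Λ) ⥤ rep_k P_n`. -/
abbrev functorF (p : Λ) : BoundedPair p 2 ⥤ PosetRep (ResidueField Λ) (ChainPoset n) :=
  (SubPair.bounded p 2).ι ⋙ repFunctor Λ n

end Functor

/-! ### The ideal `N` -/

section IdealN

variable {Λ : Type u} [CommRing Λ] [IsLocalRing Λ]

/-- The subgroup `N((B; A), (D; C))` of the morphisms `f` with `f(A + soc B) ⊆ rad C`. -/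
def idealN (p : Λ) (X Y : BoundedPair p 2) : AddSubgroup (X ⟶ Y) where
  carrier := {f | (X.obj.A ⊔ soc Λ X.obj.B).map (SubPair.linMap f.hom) ≤ rad Y.obj.A}
  add_mem' hf hg := by
    rintro _ ⟨x, hx, rfl⟩
    exact Submodule.add_mem _ (hf ⟨x, hx, rfl⟩) (hg ⟨x, hx, rfl⟩)
  zero_mem' := by
    rintro _ ⟨x, hx, rfl⟩
    exact Submodule.zero_mem _
  neg_mem' hf := by
    rintro _ ⟨x, hx, rfl⟩
    exact Submodule.neg_mem _ (hf ⟨x, hx, rfl⟩)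

theorem idealN_comp_left (p : Λ) {X Y Z : BoundedPair p 2} (f : X ⟶ Y) {g : Y ⟶ Z}
    (hg : g ∈ idealN p Y Z) : f ≫ g ∈ idealN p X Z := by
  rintro _ ⟨x, hx, rfl⟩
  exact hg ⟨_, SubPair.Aplus_le_comap f.hom hx, rfl⟩

theorem idealN_comp_right (p : Λ) {X Y Z : BoundedPair p 2} {f : X ⟶ Y} (g : Y ⟶ Z)
    (hf : f ∈ idealN p X Y) : f ≫ g ∈ idealN p X Z := by
  rintro _ ⟨x, hx, rfl⟩
  exact SubPair.Aminus_le_comap g.hom (hf ⟨x, hx, rfl⟩)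

/-- Two morphisms are congruent modulo `N` if their difference lies in `N`. -/
def relN (p : Λ) : HomRel (BoundedPair p 2) := fun X Y f g => f - g ∈ idealN p X Y

instance (p : Λ) : Congruence (relN p) where
  equivalence {X Y} :=
    { refl := fun f => by
        show f - f ∈ idealN p X Y
        rw [sub_self]
        exact zero_mem _
      symm := fun {f g} h => by
        show g - f ∈ idealN p X Y
        rw [← neg_sub]
        exact neg_mem h
      trans := fun {f g h} h₁ h₂ => by
        show f - h ∈ idealN p X Y
        rw [← sub_add_sub_cancel f g h]
        exact add_mem h₁ h₂ }
  comp_left {X Y Z} f {g g'} h := by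
    show f ≫ g - f ≫ g' ∈ idealN p X Z
    rw [← Preadditive.comp_sub]
    exact idealN_comp_left p f h
  comp_right {X Y Z f f'} g h := by
    show f ≫ g - f' ≫ g ∈ idealN p X Z
    rw [← Preadditive.sub_comp]
    exact idealN_comp_right p g h

/-- The factor category `S_2(Λ) / N`, with morphism groups `Hom(X, Y) / N(X, Y)`. -/
abbrev QuotientN (p : Λ) := CategoryTheory.Quotient (relN p)

instance (p : Λ) : Preadditive (QuotientN p) :=
  Quotient.preadditive (relN p) (fun X Y f₁ f₂ g₁ g₂ hf hg => by
    show f₁ + g₁ - (f₂ + g₂) ∈ idealN p X Y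
    rw [add_sub_add_comm]
    exact add_mem hf hg)

end IdealN

end

/-! The kernel of `F` and the conditions on its values come straight from the definitions: `p ^ n =
0` puts `rad^{n-1} B` into the socle, and `A⁺ = A + soc B`. The content is that `F` is full and
dense.

Fullness (`SubPair.exists_map_eq`): a map `h` between the representations of `(B; A)` and `(D; C)`
lifts only to a relation `R` between `A⁺` and `C⁺` (`SubPair.liftRelation`), with values determined
up to `C⁻`. As in the proof of Ulm's theorem, partial maps that do not decrease heights are
extended, where `x` has height at least `ℓ` if `x ∈ rad^ℓ`. The relation `pR` respects heights: if
`p x = p ^ (r + 1) b`, then `p ^ r b` differs from `x` by a socle element, and `h` respects both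
`V^r` and `V'`; since `p ^ 2 C = 0`, elements of `C⁻` do not disturb the socle condition. A relation
respecting heights can be enlarged at an element of maximal height in its coset modulo the domain
(`IsHeightMono.sup_span`). Doing this inside `R` reaches the domain `A⁺`; doing it freely reaches
`B`. Height `n` means zero, so the result is single-valued, hence a linear map inducing `h`.

Density (`PosetRep.exists_bounded_toRep_iso`): the chain and `V'` have a common adapted basis. A
basis vector of height `d` contributes a cyclic summand of `B` of length `d + 1` if it lies in `V'`
and `d + 2` otherwise, and corresponds to `p ^ d` times its generator. The subspace `V''` is
arbitrary and its preimage defines `A`. Admissibility makes the lengths at most `n` and makes `A⁺`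
the whole span of the chosen elements. -/

/-! ### Powers of a generator of the maximal ideal -/

section UniserialRing

variable {Λ : Type u} [CommRing Λ] [IsLocalRing Λ] {p : Λ}

theorem isUnit_of_not_dvd (hp : maximalIdeal Λ = Ideal.span {p}) {c : Λ} (hc : ¬ p ∣ c) :
    IsUnit c := by
  by_contra h
  have h' : c ∈ maximalIdeal Λ := h
  rw [hp, Ideal.mem_span_singleton] at h'
  exact hc h'

/-- Nakayama's argument for a principal ideal: the unit `1 - p * d` annihilates `p ^ j`. -/
theorem pow_eq_zero_of_succ_dvd (hp : maximalIdeal Λ = Ideal.span {p}) {j : ℕ}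
    (h : p ^ (j + 1) ∣ p ^ j) : p ^ j = 0 := by
  obtain ⟨d, hd⟩ := h
  have hpm : p ∈ maximalIdeal Λ := hp ▸ Ideal.mem_span_singleton_self p
  have hu : IsUnit (1 - p * d) :=
    isUnit_one_sub_self_of_mem_nonunits _ (Ideal.mul_mem_right d _ hpm)
  have h0 : p ^ j * (1 - p * d) = 0 := by linear_combination hd
  exact hu.mul_left_eq_zero.mp h0

/-- An element of `(p ^ j)` outside `(p ^ (j + 1))` is `p ^ j` times a unit, so it already generates
`(p ^ j)`. -/
theorem covBy_span_pow (hp : maximalIdeal Λ = Ideal.span {p}) {j : ℕ} (hj : p ^ j ≠ 0) :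
    Ideal.span {p ^ (j + 1)} ⋖ Ideal.span {p ^ j} := by
  refine ⟨lt_of_le_not_ge ?_ ?_, fun I h₁ h₂ => ?_⟩
  · exact Ideal.span_singleton_le_span_singleton.mpr (pow_dvd_pow p j.le_succ)
  · exact fun h => hj (pow_eq_zero_of_succ_dvd hp (Ideal.span_singleton_le_span_singleton.mp h))
  · obtain ⟨x, hxI, hx⟩ := SetLike.exists_of_lt h₁
    obtain ⟨c, rfl⟩ := Ideal.mem_span_singleton.mp (h₂.le hxI)
    have hc : IsUnit c := isUnit_of_not_dvd hp fun ⟨d, hd⟩ =>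
      hx (Ideal.mem_span_singleton.mpr ⟨d, by rw [hd]; ring⟩)
    exact h₂.not_ge ((Ideal.span_singleton_le_iff_mem _).mpr
      ((Ideal.mul_unit_mem_iff_mem I hc).mp hxI))

theorem length_eq_of_pow_eq_zero (hp : maximalIdeal Λ = Ideal.span {p}) {N : ℕ}
    (hN : p ^ N = 0) (hmin : ∀ j < N, p ^ j ≠ 0) : Module.length Λ Λ = N := by
  -- The exponents run downwards because a composition series ascends from `⊥` to `⊤`.
  let s : CompositionSeries (Ideal Λ) :=
    { length := N
      toFun := fun i => Ideal.span {p ^ (N - i : ℕ)}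
      step := fun i => by
        have h : N - i = N - (i + 1) + 1 := by omega
        change Ideal.span {p ^ (N - i : ℕ)} ⋖ Ideal.span {p ^ (N - (i + 1) : ℕ)}
        rw [h]
        exact covBy_span_pow hp (hmin _ (by omega)) }
  refine (Module.length_compositionSeries s ?_ ?_).symm
  · change Ideal.span {p ^ (N - 0 : ℕ)} = ⊥
    simp [hN]
  · change Ideal.span {p ^ (N - N : ℕ)} = ⊤
    simp

theorem isNilpotent_generator (n : ℕ) [h : IsUniserialOfLength Λ n]
    (hp : maximalIdeal Λ = Ideal.span {p}) : IsNilpotent p := by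
  have h1 : Module.length Λ Λ ≠ ⊤ := by rw [h.length_eq]; exact ENat.natCast_ne_top n
  have : IsArtinianRing Λ :=
    (isFiniteLength_iff_isNoetherian_isArtinian.mp (Module.length_ne_top_iff.mp h1)).2
  obtain ⟨m, hm⟩ := IsArtinianRing.isNilpotent_jacobson_bot (R := Λ)
  refine ⟨m, ?_⟩
  rw [IsLocalRing.jacobson_eq_maximalIdeal _ bot_ne_top, hp, Ideal.span_singleton_pow] at hm
  simpa using hm

/-- The powers of `p` up to the first vanishing one give a composition series, so the nilpotency
index of `p` is the length. -/
theorem pow_eq_zero_iff_length_le (n : ℕ) [h : IsUniserialOfLength Λ n]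
    (hp : maximalIdeal Λ = Ideal.span {p}) {j : ℕ} : p ^ j = 0 ↔ n ≤ j := by
  classical
  have hex : ∃ N, p ^ N = 0 := isNilpotent_generator n hp
  have hlen := length_eq_of_pow_eq_zero hp (Nat.find_spec hex) fun j hj => Nat.find_min hex hj
  rw [h.length_eq, Nat.cast_inj] at hlen
  rw [hlen]
  exact ⟨fun hj => Nat.find_min' hex hj,
    fun hj => pow_eq_zero_of_le hj (Nat.find_spec hex)⟩

theorem length_pos (n : ℕ) [IsUniserialOfLength Λ n]
    (hp : maximalIdeal Λ = Ideal.span {p}) : 0 < n := by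
  rw [Nat.pos_iff_ne_zero]
  rintro rfl
  exact one_ne_zero ((pow_zero p).symm.trans ((pow_eq_zero_iff_length_le 0 hp).mpr le_rfl))

/-- If `p ^ a c` is divisible by `p ^ b` with `a < b` and `p ^ a ≠ 0`, then `c` is not a unit. -/
theorem dvd_of_pow_dvd_pow_mul (hp : maximalIdeal Λ = Ideal.span {p}) {a b : ℕ} {c : Λ}
    (hab : a < b) (ha : p ^ a ≠ 0) (h : p ^ b ∣ p ^ a * c) : p ∣ c := by
  by_contra hc
  have hu := isUnit_of_not_dvd hp hc
  exact ha (pow_eq_zero_of_succ_dvd hp ((pow_dvd_pow p hab).trans (hu.dvd_mul_right.mp h)))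

/-- Cancellation of a factor `p` in `p ^ (m + 1) ∣ p c`. -/
theorem pow_dvd_of_succ_dvd_mul (n : ℕ) [IsUniserialOfLength Λ n]
    (hp : maximalIdeal Λ = Ideal.span {p}) {m : ℕ} {c : Λ} (hm : m < n)
    (h : p ^ (m + 1) ∣ p * c) : p ^ m ∣ c := by
  suffices H : ∀ j ≤ m, p ^ j ∣ c from H m le_rfl
  intro j
  induction j with
  | zero => simp
  | succ j ih =>
    intro hj
    obtain ⟨d, rfl⟩ := ih (by omega)
    have hd : p ∣ d := by
      refine dvd_of_pow_dvd_pow_mul hp (a := j + 1) (b := m + 1) (by omega) ?_ ?_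
      · rw [Ne, pow_eq_zero_iff_length_le n hp]
        omega
      · rwa [pow_succ' p j, mul_assoc]
    rw [pow_succ]
    exact mul_dvd_mul_left _ hd

end UniserialRing

/-! ### Radical and socle in terms of the generator -/

section Membership

variable {Λ : Type u} [CommRing Λ] [IsLocalRing Λ] {p : Λ}
variable {M : Type u} [AddCommGroup M] [Module Λ M]

theorem mem_radPow_iff (hp : maximalIdeal Λ = Ideal.span {p}) {ℓ : ℕ} {U : Submodule Λ M}
    {x : M} : x ∈ radPow ℓ U ↔ ∃ y ∈ U, p ^ ℓ • y = x := by
  rw [radPow, hp, Ideal.span_singleton_pow, Submodule.ideal_span_singleton_smul]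
  exact Submodule.mem_smul_pointwise_iff_exists _ _ _

theorem mem_rad_iff (hp : maximalIdeal Λ = Ideal.span {p}) {U : Submodule Λ M} {x : M} :
    x ∈ rad U ↔ ∃ y ∈ U, p • y = x := by
  rw [rad, hp, Submodule.ideal_span_singleton_smul]
  exact Submodule.mem_smul_pointwise_iff_exists _ _ _

theorem mem_soc_iff_smul_eq_zero (hp : maximalIdeal Λ = Ideal.span {p}) {x : M} :
    x ∈ soc Λ M ↔ p • x = 0 := by
  rw [mem_soc_iff]
  refine ⟨fun h => h p (hp ▸ Ideal.mem_span_singleton_self p), fun h r hr => ?_⟩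
  rw [hp, Ideal.mem_span_singleton] at hr
  obtain ⟨c, rfl⟩ := hr
  rw [mul_comm, mul_smul, h, smul_zero]

theorem radPow_antitone (U : Submodule Λ M) : Antitone fun ℓ => radPow ℓ U :=
  fun _ _ h => Submodule.smul_mono (Ideal.pow_le_pow_right h) le_rfl

theorem radPow_length_eq_bot (n : ℕ) [IsUniserialOfLength Λ n]
    (hp : maximalIdeal Λ = Ideal.span {p}) (U : Submodule Λ M) : radPow n U = ⊥ := by
  refine eq_bot_iff.mpr fun x hx => ?_
  obtain ⟨y, -, rfl⟩ := (mem_radPow_iff hp).mp hx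
  rw [(pow_eq_zero_iff_length_le n hp).mpr le_rfl, zero_smul]
  exact Submodule.zero_mem _

theorem radPow_zero (U : Submodule Λ M) : radPow 0 U = U := by
  rw [radPow, pow_zero, Ideal.one_eq_top, Submodule.top_smul]

end Membership

/-! ### Extending partial maps that do not decrease heights -/

section HeightRelation

/-- A submodule that contains every `x` with `p x` in it is everything, if `p` is nilpotent. -/
theorem exists_notMem_smul_mem {Λ B : Type*} [CommRing Λ] [AddCommGroup B] [Module Λ B] {p : Λ}
    {U : Submodule Λ B} (hnil : IsNilpotent p) (hU : U ≠ ⊤) :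
    ∃ x ∉ U, p • x ∈ U := by
  by_contra! h
  obtain ⟨N, hN⟩ := hnil
  refine hU (eq_top_iff.mpr fun x _ => ?_)
  -- Factors `p` are stripped off one at a time, starting from `p ^ N • x = 0`.
  have key : ∀ j, p ^ j • x ∈ U → x ∈ U := by
    intro j
    induction j with
    | zero => simp
    | succ j ih =>
      intro hj
      refine ih (by_contra fun hn => h _ hn ?_)
      rwa [smul_smul, ← pow_succ']
  exact key N (by rw [hN, zero_smul]; exact U.zero_mem)

variable {Λ : Type u} [CommRing Λ] [IsLocalRing Λ] {p : Λ}
variable {B D : Type u} [AddCommGroup B] [Module Λ B] [AddCommGroup D] [Module Λ D]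

/-- A linear relation between `B` and `D` that does not decrease heights: if `b ∈ rad^ℓ B` is
related to `d`, then `d ∈ rad^ℓ D`. -/
def IsHeightMono (G : Submodule Λ (B × D)) : Prop :=
  ∀ x ∈ G, ∀ ℓ, x.1 ∈ radPow ℓ (⊤ : Submodule Λ B) → x.2 ∈ radPow ℓ (⊤ : Submodule Λ D)

/-- A relation that does not decrease heights can be enlarged by a pair `(x, y)` for which `x` has
maximal height in its coset modulo the domain of the relation. -/
theorem IsHeightMono.sup_span (hp : maximalIdeal Λ = Ideal.span {p})
    {G : Submodule Λ (B × D)} (hG : IsHeightMono G) {x : B} {y : D}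
    (hx : ∀ g ∈ G, ∀ ℓ, x + g.1 ∈ radPow ℓ (⊤ : Submodule Λ B) →
      x ∈ radPow ℓ (⊤ : Submodule Λ B))
    (hy : ∀ ℓ, x ∈ radPow ℓ (⊤ : Submodule Λ B) → y ∈ radPow ℓ (⊤ : Submodule Λ D))
    (hxy : p • (x, y) ∈ G) : IsHeightMono (G ⊔ Submodule.span Λ {(x, y)}) := by
  intro z hz ℓ hzℓ
  obtain ⟨g, hg, w, hw, rfl⟩ := Submodule.mem_sup.mp hz
  obtain ⟨c, rfl⟩ := Submodule.mem_span_singleton.mp hw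
  -- If `p ∣ c`, the added multiple already lies in `G`. Otherwise `c` is a unit, and after division
  -- by `c` the maximal height of `x` bounds the heights of `x` and `g.1` separately.
  by_cases hc : p ∣ c
  · obtain ⟨d, rfl⟩ := hc
    refine hG _ (G.add_mem hg ?_) ℓ hzℓ
    rw [mul_comm, mul_smul]
    exact G.smul_mem d hxy
  · obtain ⟨v, rfl⟩ := isUnit_of_not_dvd hp hc
    have hxℓ : x ∈ radPow ℓ (⊤ : Submodule Λ B) := by
      refine hx _ (G.smul_mem (↑v⁻¹ : Λ) hg) ℓ ?_
      have := Submodule.smul_mem _ (↑v⁻¹ : Λ) hzℓ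
      simpa [smul_smul, add_comm] using this
    have hgℓ : g.1 ∈ radPow ℓ (⊤ : Submodule Λ B) := by
      have := Submodule.sub_mem _ hzℓ (Submodule.smul_mem _ (v : Λ) hxℓ)
      simpa using this
    exact Submodule.add_mem _ (hG g hg ℓ hgℓ) (Submodule.smul_mem _ _ (hy ℓ hxℓ))

/-- An element of maximal height in a coset that does not contain `0`. -/
theorem exists_maximal_height (n : ℕ) [IsUniserialOfLength Λ n]
    (hp : maximalIdeal Λ = Ideal.span {p}) (U : Submodule Λ B) {x : B} (hx : x ∉ U) :
    ∃ u ∈ U, ∃ r < n, x + u ∈ radPow r (⊤ : Submodule Λ B) ∧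
      ∀ w ∈ U, ∀ ℓ, x + u + w ∈ radPow ℓ (⊤ : Submodule Λ B) → ℓ ≤ r := by
  classical
  let P : ℕ → Prop := fun r => ∃ u ∈ U, x + u ∈ radPow r (⊤ : Submodule Λ B)
  have hP0 : P 0 := ⟨0, U.zero_mem, by rw [radPow_zero]; exact Submodule.mem_top⟩
  -- Height at least `n` would make `x + u` zero and put `x` into `U`.
  have hlt : ∀ r, P r → r < n := by
    rintro r ⟨u, hu, h⟩
    by_contra! hr
    have h0 : x + u ∈ radPow n (⊤ : Submodule Λ B) := radPow_antitone _ hr h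
    rw [radPow_length_eq_bot n hp, Submodule.mem_bot] at h0
    exact hx (by rw [eq_neg_of_add_eq_zero_left h0]; exact U.neg_mem hu)
  obtain ⟨u, hu, hr⟩ := Nat.findGreatest_spec (P := P) (Nat.zero_le n) hP0
  refine ⟨u, hu, _, hlt _ ⟨u, hu, hr⟩, hr, fun w hw ℓ h => ?_⟩
  have hℓ : P ℓ := ⟨u + w, U.add_mem hu hw, by rwa [← add_assoc]⟩
  exact Nat.le_findGreatest (hlt ℓ hℓ).le hℓ

/-- A relation that does not decrease heights and is contained in a relation `R` can be enlarged
within `R` to one with the same domain as `R`, provided that it contains `pR` and that heights can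
be respected one element at a time. -/
theorem IsHeightMono.exists_extension_within (n : ℕ) [IsUniserialOfLength Λ n]
    [IsNoetherian Λ B] [IsNoetherian Λ D]
    (hp : maximalIdeal Λ = Ideal.span {p}) {G₀ R : Submodule Λ (B × D)} (hG₀ : IsHeightMono G₀)
    (hle : G₀ ≤ R) (hpR : ∀ z ∈ R, p • z ∈ G₀)
    (hlift : ∀ x ∈ R.map (LinearMap.fst Λ B D), ∀ r < n, x ∈ radPow r (⊤ : Submodule Λ B) →
      ∃ y ∈ radPow r (⊤ : Submodule Λ D), (x, y) ∈ R) :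
    ∃ G : Submodule Λ (B × D), IsHeightMono G ∧ G ≤ R ∧
      G.map (LinearMap.fst Λ B D) = R.map (LinearMap.fst Λ B D) := by
  obtain ⟨G, ⟨hG, hG₀G, hGR⟩, hmax⟩ := set_has_maximal_iff_noetherian.mpr
    (inferInstanceAs (IsNoetherian Λ (B × D)))
    {G : Submodule Λ (B × D) | IsHeightMono G ∧ G₀ ≤ G ∧ G ≤ R} ⟨G₀, hG₀, le_rfl, hle⟩
  refine ⟨G, hG, hGR, le_antisymm (Submodule.map_mono hGR) fun x hx => ?_⟩
  by_contra hxG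
  obtain ⟨u, hu, r, hrn, hr, hmaxr⟩ := exists_maximal_height n hp _ hxG
  have hxu : x + u ∈ R.map (LinearMap.fst Λ B D) :=
    Submodule.add_mem _ hx (Submodule.map_mono hGR hu)
  obtain ⟨y, hy, hxy⟩ := hlift _ hxu r hrn hr
  have hxu' : x + u ∉ G.map (LinearMap.fst Λ B D) := fun h =>
    hxG (by simpa using Submodule.sub_mem _ h hu)
  refine hmax (G ⊔ Submodule.span Λ {(x + u, y)}) ⟨?_, hG₀G.trans le_sup_left, ?_⟩ ?_
  · refine hG.sup_span hp (fun g hg ℓ hℓ => ?_) (fun ℓ hℓ => ?_) (hG₀G (hpR _ hxy))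
    · exact radPow_antitone _ (hmaxr _ ⟨g, hg, rfl⟩ ℓ hℓ) hr
    · exact radPow_antitone _ (hmaxr 0 (Submodule.zero_mem _) ℓ (by rwa [add_zero])) hy
  · exact sup_le hGR ((Submodule.span_singleton_le_iff_mem _ _).mpr hxy)
  · refine lt_of_le_not_ge le_sup_left fun h => hxu' ⟨(x + u, y), h ?_, rfl⟩
    exact Submodule.mem_sup_right (Submodule.mem_span_singleton_self _)

/-- A relation that does not decrease heights is contained in the graph of a linear map. -/
theorem IsHeightMono.exists_linearMap (n : ℕ) [IsUniserialOfLength Λ n]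
    [IsNoetherian Λ B] [IsNoetherian Λ D]
    (hp : maximalIdeal Λ = Ideal.span {p}) {G₀ : Submodule Λ (B × D)} (hG₀ : IsHeightMono G₀) :
    ∃ f : B →ₗ[Λ] D, ∀ z ∈ G₀, f z.1 = z.2 := by
  obtain ⟨G, ⟨hG, hG₀G⟩, hmax⟩ := set_has_maximal_iff_noetherian.mpr
    (inferInstanceAs (IsNoetherian Λ (B × D)))
    {G : Submodule Λ (B × D) | IsHeightMono G ∧ G₀ ≤ G} ⟨G₀, hG₀, le_rfl⟩
  have htop : G.map (LinearMap.fst Λ B D) = ⊤ := by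
    by_contra hne
    obtain ⟨x, hxG, hpx⟩ := exists_notMem_smul_mem (isNilpotent_generator n hp) hne
    obtain ⟨u, hu, r, -, hr, hmaxr⟩ := exists_maximal_height n hp _ hxG
    have hxu : x + u ∉ G.map (LinearMap.fst Λ B D) := fun h =>
      hxG (by simpa using Submodule.sub_mem _ h hu)
    have hpxu : p • (x + u) ∈ G.map (LinearMap.fst Λ B D) := by
      rw [smul_add]
      exact Submodule.add_mem _ hpx (Submodule.smul_mem _ _ hu)
    obtain ⟨⟨b, w⟩, hbw, hb⟩ := hpxu
    obtain rfl : b = p • (x + u) := hb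
    obtain ⟨b, -, hb⟩ := (mem_radPow_iff hp).mp hr
    have hw : w ∈ radPow (r + 1) (⊤ : Submodule Λ D) := by
      refine hG _ hbw (r + 1) ((mem_radPow_iff hp).mpr ⟨b, Submodule.mem_top, ?_⟩)
      rw [← hb, smul_smul, ← pow_succ']
    obtain ⟨d, -, rfl⟩ := (mem_radPow_iff hp).mp hw
    -- The value for `x + u`: its height is at least `r`, and `p` times it is the value already
    -- prescribed at `p • (x + u)`.
    have hd : p ^ r • d ∈ radPow r (⊤ : Submodule Λ D) :=
      (mem_radPow_iff hp).mpr ⟨d, Submodule.mem_top, rfl⟩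
    refine hmax (G ⊔ Submodule.span Λ {(x + u, p ^ r • d)}) ⟨?_, hG₀G.trans le_sup_left⟩ ?_
    · refine hG.sup_span hp (fun g hg ℓ hℓ => ?_) (fun ℓ hℓ => ?_) ?_
      · exact radPow_antitone _ (hmaxr _ ⟨g, hg, rfl⟩ ℓ hℓ) hr
      · exact radPow_antitone _ (hmaxr 0 (Submodule.zero_mem _) ℓ (by rwa [add_zero])) hd
      · rw [Prod.smul_mk, smul_smul, ← pow_succ']
        exact hbw
    · refine lt_of_le_not_ge le_sup_left fun h => hxu ⟨(x + u, p ^ r • d), h ?_, rfl⟩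
      exact Submodule.mem_sup_right (Submodule.mem_span_singleton_self _)
  -- Since `rad^n D = 0`, respecting heights forces a pair with first entry `0` to vanish; so `G` is
  -- a graph.
  have hbij : Function.Bijective ((LinearMap.fst Λ B D).domRestrict G) := by
    constructor
    · refine (injective_iff_map_eq_zero _).mpr fun z hz => ?_
      have hz1 : z.1.1 = 0 := hz
      have hz2 := hG z.1 z.2 n (by rw [hz1]; exact Submodule.zero_mem _)
      rw [radPow_length_eq_bot n hp, Submodule.mem_bot] at hz2
      exact Subtype.ext (Prod.ext hz1 hz2)
    · intro b
      obtain ⟨z, hz, hb⟩ : b ∈ G.map (LinearMap.fst Λ B D) := htop ▸ Submodule.mem_top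
      exact ⟨⟨z, hz⟩, hb⟩
  let e := LinearEquiv.ofBijective _ hbij
  refine ⟨LinearMap.snd Λ B D ∘ₗ G.subtype ∘ₗ e.symm.toLinearMap, fun z hz => ?_⟩
  have : e.symm z.1 = ⟨z, hG₀G hz⟩ := e.symm_apply_eq.mpr rfl
  simp [this]

end HeightRelation

/-! ### Membership in `C~` -/

namespace SubPair

variable {Λ : Type u} [CommRing Λ] [IsLocalRing Λ] {p : Λ}

theorem proj_mem_tilde_iff (X : SubPair Λ) (C : Submodule Λ X.B) (x : X.Aplus) :
    X.proj x ∈ X.tilde C ↔ (x : X.B) ∈ C ⊓ X.Aplus ⊔ X.Aminus := by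
  constructor
  · rintro ⟨y, hy, hyx⟩
    have h : X.proj (x - y) = 0 := by rw [map_sub, sub_eq_zero]; exact hyx.symm
    rw [proj_eq_zero_iff] at h
    have h' := Submodule.add_mem _ (show (y : X.B) ∈ C ⊓ X.Aplus ⊔ X.Aminus from hy)
      (Submodule.mem_sup_right h)
    simpa using h'
  · exact fun h => ⟨x, h, rfl⟩

theorem proj_mem_tilde_of_mem (X : SubPair Λ) {C : Submodule Λ X.B} {x : X.Aplus}
    (hx : (x : X.B) ∈ C) : X.proj x ∈ X.tilde C :=
  (X.proj_mem_tilde_iff C x).mpr (Submodule.mem_sup_left ⟨hx, x.2⟩)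

/-- A correction by an element of `A⁻` moves a representative into `C`. This is how values of `h`
get representatives of prescribed height. -/
theorem exists_proj_eq_of_mem_tilde (X : SubPair Λ) {C : Submodule Λ X.B} {v : X.TotalSpace}
    (hv : v ∈ X.tilde C) : ∃ x : X.Aplus, (x : X.B) ∈ C ∧ X.proj x = v := by
  obtain ⟨y, rfl⟩ := X.proj_surjective v
  obtain ⟨c, hc, a, ha, hca⟩ := Submodule.mem_sup.mp ((X.proj_mem_tilde_iff C y).mp hv)
  refine ⟨⟨c, hc.2⟩, hc.1, ?_⟩
  rw [← sub_eq_zero, ← map_sub, proj_eq_zero_iff]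
  have : c - (y : X.B) = -a := by rw [← hca]; abel
  change c - (y : X.B) ∈ X.Aminus
  rw [this]
  exact Submodule.neg_mem _ ha

/-- Here `p ^ 2 A = 0` enters: because of it, lying in the socle depends only on the class modulo
`A⁻`. -/
theorem Aminus_le_soc (hp : maximalIdeal Λ = Ideal.span {p}) {X : SubPair Λ}
    (hX : bounded p 2 X) : X.Aminus ≤ soc Λ X.B := by
  intro x hx
  obtain ⟨a, ha, rfl⟩ := (mem_rad_iff hp).mp hx
  rw [mem_soc_iff_smul_eq_zero hp, smul_smul, ← pow_two]
  exact hX a ha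

theorem proj_mem_tilde_soc_iff (hp : maximalIdeal Λ = Ideal.span {p}) {X : SubPair Λ}
    (hX : bounded p 2 X) (x : X.Aplus) :
    X.proj x ∈ X.tilde (soc Λ X.B) ↔ (x : X.B) ∈ soc Λ X.B :=
  ⟨fun h => sup_le inf_le_left (Aminus_le_soc hp hX) ((X.proj_mem_tilde_iff _ x).mp h),
    X.proj_mem_tilde_of_mem⟩

theorem proj_mem_tilde_A_iff {X : SubPair Λ} (x : X.Aplus) :
    X.proj x ∈ X.tilde X.A ↔ (x : X.B) ∈ X.A :=
  ⟨fun h => sup_le inf_le_left (rad_le X.A) ((X.proj_mem_tilde_iff _ x).mp h),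
    X.proj_mem_tilde_of_mem⟩

theorem residue_smul_totalSpace (X : SubPair Λ) (r : Λ) (v : X.TotalSpace) :
    residue Λ r • v = r • v := by
  rw [← IsLocalRing.ResidueField.algebraMap_eq, algebraMap_smul]

/-- The relation between `B` and `D` formed by the pairs of elements of `A⁺` and `C⁺` whose classes
correspond to each other under `h`. -/
def liftRelation {X Y : SubPair Λ} (h : X.TotalSpace →ₗ[ResidueField Λ] Y.TotalSpace) :
    Submodule Λ (X.B × Y.B) where
  carrier := {z | ∃ (h₁ : z.1 ∈ X.Aplus) (h₂ : z.2 ∈ Y.Aplus),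
    h (X.proj ⟨z.1, h₁⟩) = Y.proj ⟨z.2, h₂⟩}
  add_mem' := by
    rintro z w ⟨h₁, h₂, e⟩ ⟨h₃, h₄, e'⟩
    refine ⟨add_mem h₁ h₃, add_mem h₂ h₄, ?_⟩
    change h (X.proj (⟨z.1, h₁⟩ + ⟨w.1, h₃⟩)) = Y.proj (⟨z.2, h₂⟩ + ⟨w.2, h₄⟩)
    rw [map_add, map_add, map_add, e, e']
  zero_mem' := ⟨zero_mem _, zero_mem _, by
    change h (X.proj 0) = Y.proj 0
    simp⟩
  smul_mem' := by
    rintro c z ⟨h₁, h₂, e⟩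
    refine ⟨Submodule.smul_mem _ c h₁, Submodule.smul_mem _ c h₂, ?_⟩
    change h (X.proj (c • ⟨z.1, h₁⟩)) = Y.proj (c • ⟨z.2, h₂⟩)
    rw [map_smul X.proj, map_smul Y.proj, ← e, ← residue_smul_totalSpace, map_smul,
      residue_smul_totalSpace]

theorem exists_mem_liftRelation {X Y : SubPair Λ}
    (h : X.TotalSpace →ₗ[ResidueField Λ] Y.TotalSpace) {x : X.B} (hx : x ∈ X.Aplus)
    {D : Submodule Λ Y.B} (hD : h (X.proj ⟨x, hx⟩) ∈ Y.tilde D) :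
    ∃ y ∈ D, (x, y) ∈ liftRelation h := by
  obtain ⟨y, hy, e⟩ := Y.exists_proj_eq_of_mem_tilde hD
  exact ⟨y, hy, hx, y.2, e.symm⟩

theorem map_fst_liftRelation {X Y : SubPair Λ}
    (h : X.TotalSpace →ₗ[ResidueField Λ] Y.TotalSpace) :
    (liftRelation h).map (LinearMap.fst Λ X.B Y.B) = X.Aplus := by
  ext x
  constructor
  · rintro ⟨z, ⟨h₁, -⟩, rfl⟩
    exact h₁
  · intro hx
    obtain ⟨y, hy⟩ := Y.proj_surjective (h (X.proj ⟨x, hx⟩))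
    exact ⟨(x, y), ⟨hx, y.2, hy.symm⟩, rfl⟩

variable (n : ℕ) [IsUniserialOfLength Λ n]

/-- At `r = 0` there is no point of the poset, but `rad^0` is the whole module and the condition is
empty. -/
theorem mem_tilde_radPow_of_lt {X Y : SubPair Λ} (h : X.toRep n ⟶ Y.toRep n) {r : ℕ} (hr : r < n)
    {x : X.TotalSpace} (hx : x ∈ X.tilde (radPow r ⊤)) :
    PosetRep.linMap h x ∈ Y.tilde (radPow r ⊤) := by
  rcases Nat.eq_zero_or_pos r with rfl | hr0
  · rw [radPow_zero]
    obtain ⟨y, hy⟩ := Y.proj_surjective (PosetRep.linMap h x)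
    rw [← hy]
    exact Y.proj_mem_tilde_of_mem Submodule.mem_top
  · exact PosetRep.Hom.le_comap h (.chain r hr0 hr) hx

/-- On `A⁻`, the map induced by `h` does not decrease heights. -/
theorem isHeightMono_smul_liftRelation (hp : maximalIdeal Λ = Ideal.span {p}) {X Y : SubPair Λ}
    (hY : bounded p 2 Y) (h : X.toRep n ⟶ Y.toRep n) :
    IsHeightMono (Submodule.map (LinearMap.lsmul Λ (X.B × Y.B) p)
      (liftRelation (X := X) (Y := Y) (PosetRep.linMap h))) := by
  rintro _ ⟨⟨x, y⟩, ⟨hx, hy, e⟩, rfl⟩ ℓ hℓ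
  change p • x ∈ _ at hℓ
  change p • y ∈ _
  -- If `x' - x ∈ soc B`, then any `y'` related to `x'` satisfies `p y' = p y`.
  have key : ∀ x' y', (x', y') ∈ liftRelation (X := X) (Y := Y) (PosetRep.linMap h) →
      p • x' = p • x → p • y' = p • y := by
    rintro x' y' ⟨hx', hy', e'⟩ hxx
    have hs : X.proj (⟨x', hx'⟩ - ⟨x, hx⟩) ∈ X.tilde (soc Λ X.B) := by
      refine X.proj_mem_tilde_of_mem ((mem_soc_iff_smul_eq_zero hp).mpr ?_)
      change p • (x' - x) = 0
      rw [smul_sub, hxx, sub_self]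
    have hs' := PosetRep.Hom.le_comap h .prime hs
    have e2 : PosetRep.linMap h (X.proj (⟨x', hx'⟩ - ⟨x, hx⟩)) = Y.proj (⟨y', hy'⟩ - ⟨y, hy⟩) := by
      rw [map_sub, map_sub]
      exact (map_sub (PosetRep.linMap h) _ _).trans (congrArg₂ (· - ·) e' e)
    have hs2 : Y.proj (⟨y', hy'⟩ - ⟨y, hy⟩) ∈ Y.tilde (soc Λ Y.B) := e2 ▸ hs'
    have := (mem_soc_iff_smul_eq_zero hp).mp ((proj_mem_tilde_soc_iff hp hY _).mp hs2)
    change p • (y' - y) = 0 at this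
    rwa [smul_sub, sub_eq_zero] at this
  -- If `p • x = 0`, comparison with `(0, 0)` gives `p • y = 0`. In the other case `r < n` follows,
  -- so that `V^r` is available.
  by_cases hz : p • x = 0
  · have := key 0 0 (Submodule.zero_mem _) (by rw [hz, smul_zero])
    rw [← this, smul_zero]
    exact Submodule.zero_mem _
  obtain rfl | ⟨r, rfl⟩ : ℓ = 0 ∨ ∃ r, ℓ = r + 1 := by
    cases ℓ with
    | zero => exact Or.inl rfl
    | succ r => exact Or.inr ⟨r, rfl⟩
  · rw [radPow_zero]
    exact Submodule.mem_top
  · obtain ⟨b, -, hb⟩ := (mem_radPow_iff hp).mp hℓ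
    have hrn : r < n := by
      by_contra! hrn
      apply hz
      rw [← hb, (pow_eq_zero_iff_length_le n hp).mpr (by omega), zero_smul]
    have hpb : p • (p ^ r • b) = p • x := by rw [smul_smul, ← pow_succ', hb]
    -- Since `p ^ r • b` differs from `x` by a socle element, it stays in `A⁺`; its class lies in
    -- `V^r`, which `h` preserves.
    have hbA : p ^ r • b ∈ X.Aplus := by
      have hs : p ^ r • b - x ∈ soc Λ X.B :=
        (mem_soc_iff_smul_eq_zero hp).mpr (by rw [smul_sub, hpb, sub_self])
      have := X.Aplus.add_mem hx (Submodule.mem_sup_right hs)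
      simpa using this
    have hbr : X.proj ⟨_, hbA⟩ ∈ X.tilde (radPow r ⊤) :=
      X.proj_mem_tilde_of_mem ((mem_radPow_iff hp).mpr ⟨b, Submodule.mem_top, rfl⟩)
    obtain ⟨y', hy', hrel⟩ := exists_mem_liftRelation (PosetRep.linMap h) hbA
      (mem_tilde_radPow_of_lt n h hrn hbr)
    rw [← key _ _ hrel hpb]
    obtain ⟨d, -, rfl⟩ := (mem_radPow_iff hp).mp hy'
    rw [smul_smul, ← pow_succ']
    exact (mem_radPow_iff hp).mpr ⟨d, Submodule.mem_top, rfl⟩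

/-- Every morphism between the representations of two pairs in `S_2(Λ)` is induced by a morphism
of pairs. -/
theorem exists_map_eq (hp : maximalIdeal Λ = Ideal.span {p}) {X Y : SubPair Λ}
    (hY : bounded p 2 Y) (h : X.toRep n ⟶ Y.toRep n) :
    ∃ f : X ⟶ Y, (repFunctor Λ n).map f = h := by
  have := IsUniserialOfLength.isNoetherianRing Λ n
  have hN := isHeightMono_smul_liftRelation n hp hY h
  set R := liftRelation (X := X) (Y := Y) (PosetRep.linMap h)
  have hdom : R.map (LinearMap.fst Λ X.B Y.B) = X.Aplus := map_fst_liftRelation _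
  obtain ⟨G, hG, hGR, hGdom⟩ := hN.exists_extension_within n hp (R := R)
    (by rintro _ ⟨z, hz, rfl⟩; exact R.smul_mem p hz) (fun z hz => ⟨z, hz, rfl⟩)
    (fun x hx r hr hxr => by
      rw [hdom] at hx
      exact exists_mem_liftRelation (PosetRep.linMap h) hx
        (mem_tilde_radPow_of_lt n h hr (X.proj_mem_tilde_of_mem hxr)))
  rw [hdom] at hGdom
  obtain ⟨f, hf⟩ := hG.exists_linearMap n hp
  have hfR : ∀ x ∈ X.Aplus, (x, f x) ∈ R := by
    intro x hx
    rw [← hGdom] at hx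
    obtain ⟨z, hz, rfl⟩ := hx
    have := hf z hz
    change (z.1, f z.1) ∈ R
    rw [this]
    exact hGR hz
  -- As `C⁻ ⊆ C`, membership in `C` can be tested on classes, where `h` respects the point `1''`.
  have hfA : X.A ≤ Y.A.comap f := by
    intro a ha
    obtain ⟨h₁, h₂, e⟩ := hfR a (Submodule.mem_sup_left ha)
    have h3 := PosetRep.Hom.le_comap h .dprime (X.proj_mem_tilde_of_mem (x := ⟨a, h₁⟩) ha)
    have h4 : Y.proj ⟨f a, h₂⟩ ∈ Y.tilde Y.A := e ▸ h3
    exact (proj_mem_tilde_A_iff _).mp h4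
  refine ⟨Hom.mk f hfA, PosetRep.hom_ext (LinearMap.ext fun v => ?_)⟩
  obtain ⟨x, rfl⟩ := X.proj_surjective v
  obtain ⟨h₁, h₂, e⟩ := hfR x x.2
  exact e.symm

end SubPair

/-! ### Bases adapted to a filtration and a subspace -/

section AdaptedBasis

variable {k : Type*} {V : Type u} [Field k] [AddCommGroup V] [Module k V]

/-- A linearly independent set that is adapted to a descending filtration extends to one that spans
each term of the filtration. -/
theorem exists_linearIndepOn_adapted (F : ℕ → Submodule k V) (hF : Antitone F) {N : ℕ}
    (hN : F N = ⊥) {s : Set V} (hs : LinearIndepOn k id s)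
    (hsF : ∀ j, Submodule.span k s ⊓ F j ≤ Submodule.span k (s ∩ F j)) :
    ∃ b, s ⊆ b ∧ b ⊆ s ∪ F 0 ∧ LinearIndepOn k id b ∧
      ∀ j, F j ≤ Submodule.span k (b ∩ F j) := by
  -- Induction from the zero end of the filtration: for `m ≥ N` the set `s` suffices, and each step
  -- passes from `F (m + 1)` to `F m`.
  suffices H : ∀ i m, N ≤ m + i → ∃ b, s ⊆ b ∧ b ⊆ s ∪ F m ∧ LinearIndepOn k id b ∧
      ∀ j, m ≤ j → F j ≤ Submodule.span k (b ∩ F j) by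
    obtain ⟨b, h₁, h₂, h₃, h₄⟩ := H N 0 (by omega)
    exact ⟨b, h₁, h₂, h₃, fun j => h₄ j (Nat.zero_le j)⟩
  intro i
  induction i with
  | zero =>
    intro m hm
    refine ⟨s, subset_rfl, Set.subset_union_left, hs, fun j hj => ?_⟩
    have : F j ≤ F N := hF (by omega)
    rw [hN] at this
    exact this.trans bot_le
  | succ i ih =>
    intro m hm
    obtain ⟨c, hsc, hc, hcli, hcF⟩ := ih (m + 1) (by omega)
    obtain ⟨b, hb, hcb, hspan, hbli⟩ :=
      exists_linearIndepOn_id_extension hcli (Set.subset_union_left (t := (F m : Set V)))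
    have hbsub : b ⊆ s ∪ F m := by
      intro x hx
      rcases hb hx with h | h
      · rcases hc h with h | h
        · exact Or.inl h
        · exact Or.inr (hF m.le_succ h)
      · exact Or.inr h
    refine ⟨b, hsc.trans hcb, hbsub, hbli, fun j hj => ?_⟩
    rcases hj.eq_or_lt with rfl | hj
    · intro x hx
      -- Members of `b` outside `s` lie in `F m`; so the `s`-part of an element of `F m` is also in
      -- `F m`, where `hsF` applies.
      have hxb : x ∈ Submodule.span k s ⊔ Submodule.span k (b ∩ F m) := by
        rw [← Submodule.span_union]
        refine Submodule.span_mono (fun y hy => ?_) (hspan (Or.inr hx))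
        rcases hbsub hy with h | h
        · exact Or.inl h
        · exact Or.inr ⟨hy, h⟩
      obtain ⟨v, hv, w, hw, rfl⟩ := Submodule.mem_sup.mp hxb
      have hwF : w ∈ F m := Submodule.span_le.mpr Set.inter_subset_right hw
      have hvF : v ∈ F m := by simpa using (F m).sub_mem hx hwF
      exact Submodule.add_mem _ (Submodule.span_mono
        (Set.inter_subset_inter_left _ (hsc.trans hcb)) (hsF m ⟨hv, hvF⟩)) hw
    · exact (hcF j hj).trans (Submodule.span_mono (Set.inter_subset_inter_left _ hcb))

/-- The basis vectors lying in `W` span it, so `W` is a coordinate subspace. -/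
theorem Module.Basis.mem_iff_repr_eq_zero {ι : Type*} (e : Module.Basis ι k V) {W : Submodule k V}
    (hW : W ≤ Submodule.span k (Set.range e ∩ W)) {x : V} :
    x ∈ W ↔ ∀ i, e i ∉ W → e.repr x i = 0 := by
  have hspan : Submodule.span k (e '' {i | e i ∈ W}) = W := by
    refine le_antisymm (Submodule.span_le.mpr ?_) (hW.trans (Submodule.span_mono ?_))
    · rintro _ ⟨i, hi, rfl⟩
      exact hi
    · rintro _ ⟨⟨i, rfl⟩, hi⟩
      exact ⟨i, hi, rfl⟩
  conv_lhs => rw [← hspan, e.mem_span_image]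
  constructor
  · intro h i hi
    by_contra h0
    exact hi (h (Finsupp.mem_support_iff.mpr h0))
  · intro h i hi
    by_contra h0
    exact Finsupp.mem_support_iff.mp hi (h i h0)

/-- A basis adapted to a descending filtration and a further subspace. -/
theorem exists_basis_adapted [FiniteDimensional k V] (F : ℕ → Submodule k V) (hF : Antitone F)
    {N : ℕ} (h0 : F 0 = ⊤) (hN : F N = ⊥) (W : Submodule k V) :
    ∃ (ι : Type u) (_ : Fintype ι) (e : Module.Basis ι k V),
      (∀ j x, x ∈ F j ↔ ∀ i, e i ∉ F j → e.repr x i = 0) ∧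
      (∀ x, x ∈ W ↔ ∀ i, e i ∉ W → e.repr x i = 0) := by
  -- A basis of `W` adapted to the induced filtration comes first; it then meets the compatibility
  -- condition for an extension to all of `V`.
  obtain ⟨s, -, hsW, hsli, hsF⟩ := exists_linearIndepOn_adapted (fun j => W ⊓ F j)
    (fun i j h => inf_le_inf_left W (hF h)) (N := N) (by simp [hN]) (s := ∅)
    (linearIndepOn_empty k id) (fun j => by simp)
  have hsW' : s ⊆ W := fun x hx => by
    rcases hsW hx with h | h
    · exact h.elim
    · exact h.1
  have hWs : W ≤ Submodule.span k s := by
    have := hsF 0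
    simp only [h0, inf_top_eq] at this
    exact this.trans (Submodule.span_mono Set.inter_subset_left)
  obtain ⟨b, hsb, -, hbli, hbF⟩ := exists_linearIndepOn_adapted F hF hN hsli (fun j => by
    refine (inf_le_inf_right _ (Submodule.span_le.mpr hsW')).trans ((hsF j).trans ?_)
    exact Submodule.span_mono (Set.inter_subset_inter_right s fun x hx => hx.2))
  have hspan : ⊤ ≤ Submodule.span k b := by
    rw [← h0]
    exact (hbF 0).trans (Submodule.span_mono Set.inter_subset_left)
  let e : Module.Basis b k V := Module.Basis.mk hbli (by simpa using hspan)
  have he : Set.range e = b := by simp [e]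
  have : Finite b := Module.Finite.finite_basis e
  refine ⟨b, Fintype.ofFinite b, e, fun j x => e.mem_iff_repr_eq_zero (by rw [he]; exact hbF j),
    fun x => e.mem_iff_repr_eq_zero ?_⟩
  rw [he]
  exact hWs.trans (Submodule.span_mono fun x hx => ⟨hsb hx, hsW' hx⟩)

end AdaptedBasis

/-! ### Recognising the representation of a pair -/

section Presentation

variable {Λ : Type u} [CommRing Λ] [IsLocalRing Λ] {n : ℕ} [IsUniserialOfLength Λ n]

/-- A representation is isomorphic to that of a pair if both are compatible quotients of the same
module. -/
theorem SubPair.nonempty_toRep_iso {X : SubPair Λ} {V : PosetRep (ResidueField Λ) (ChainPoset n)}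
    {L : Type u} [AddCommGroup L] [Module Λ L] (φ : L →ₗ[Λ] X.B) (ψ : L →ₛₗ[residue Λ] V.V)
    (hψ : Function.Surjective ψ) (hφ : LinearMap.range φ = X.Aplus)
    (hker : ∀ μ, φ μ ∈ X.Aminus ↔ ψ μ = 0)
    (hsub : ∀ i μ, φ μ ∈ X.pointSubmodule i ⊓ X.Aplus ⊔ X.Aminus ↔ ψ μ ∈ V.sub i) :
    Nonempty (X.toRep n ≅ V) := by
  have hmem : ∀ μ, φ μ ∈ X.Aplus := fun μ => hφ ▸ ⟨μ, rfl⟩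
  let g : L →ₗ[Λ] X.TotalSpace := X.proj ∘ₗ φ.codRestrict X.Aplus hmem
  have hg : Function.Surjective g := by
    intro t
    obtain ⟨⟨x, hx⟩, rfl⟩ := X.proj_surjective t
    obtain ⟨μ, rfl⟩ : x ∈ LinearMap.range φ := hφ ▸ hx
    exact ⟨μ, rfl⟩
  have hg0 : ∀ μ, g μ = 0 ↔ ψ μ = 0 := fun μ => (X.proj_eq_zero_iff _).trans (hker μ)
  have hgψ : ∀ μ ν, g μ = g ν ↔ ψ μ = ψ ν := fun μ ν => by
    rw [← sub_eq_zero, ← map_sub, hg0, map_sub, sub_eq_zero]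
  have hres : ∀ (r : Λ) μ, g (r • μ) = residue Λ r • g μ := fun r μ => by
    rw [map_smul, SubPair.residue_smul_totalSpace]
  -- Any section of `g` serves, since `g` and `ψ` have the same fibres.
  let T : X.TotalSpace → V.V := fun t => ψ (Function.surjInv hg t)
  have hT : ∀ μ, T (g μ) = ψ μ := fun μ => (hgψ _ _).mp (Function.surjInv_eq hg _)
  let T' : X.TotalSpace →ₗ[ResidueField Λ] V.V :=
    { toFun := T
      map_add' := fun s t => by
        obtain ⟨μ, rfl⟩ := hg s
        obtain ⟨ν, rfl⟩ := hg t
        rw [← map_add, hT, hT, hT, map_add]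
      map_smul' := fun c t => by
        obtain ⟨μ, rfl⟩ := hg t
        obtain ⟨r, rfl⟩ := IsLocalRing.residue_surjective c
        rw [← hres, hT, hT, map_smulₛₗ, RingHom.id_apply] }
  have hT' : ∀ μ, T' (g μ) = ψ μ := hT
  have hbij : Function.Bijective T' := by
    constructor
    · intro s t hst
      obtain ⟨μ, rfl⟩ := hg s
      obtain ⟨ν, rfl⟩ := hg t
      rw [hT', hT'] at hst
      exact (hgψ _ _).mpr hst
    · intro v
      obtain ⟨μ, rfl⟩ := hψ v
      exact ⟨g μ, hT' μ⟩
  let E : X.TotalSpace ≃ₗ[ResidueField Λ] V.V := LinearEquiv.ofBijective T' hbij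
  have hE : ∀ i t, t ∈ X.tilde (X.pointSubmodule i) ↔ E t ∈ V.sub i := fun i t => by
    obtain ⟨μ, rfl⟩ := hg t
    have : E (g μ) = ψ μ := hT' μ
    rw [this, ← hsub]
    exact X.proj_mem_tilde_iff _ _
  exact ⟨{
    hom := PosetRep.Hom.mk (V := X.toRep n) E.toLinearMap fun i t ht => (hE i t).mp ht
    inv := PosetRep.Hom.mk (W := X.toRep n) E.symm.toLinearMap fun i v hv => by
      refine (hE i _).mpr ?_
      change E (E.symm v) ∈ V.sub i
      rwa [E.apply_symm_apply]
    hom_inv_id := PosetRep.hom_ext (LinearMap.ext fun t => E.symm_apply_apply t)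
    inv_hom_id := PosetRep.hom_ext (LinearMap.ext fun v => E.apply_symm_apply v) }⟩

end Presentation

noncomputable section

/-! ### Realising representations -/

section Realisation

variable {Λ : Type u} [CommRing Λ] {ι : Type u}

/-- The direct sum of the cyclic modules `Λ / (p ^ m i)`. -/
abbrev CyclicSum (p : Λ) (m : ι → ℕ) : Type u :=
  (ι → Λ) ⧸ Submodule.pi Set.univ fun i => Ideal.span {p ^ m i}

theorem CyclicSum.mk_eq_zero_iff {p : Λ} {m : ι → ℕ} {x : ι → Λ} :
    (Submodule.Quotient.mk x : CyclicSum p m) = 0 ↔ ∀ i, p ^ m i ∣ x i := by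
  simp [Submodule.Quotient.mk_eq_zero, Submodule.mem_pi, Ideal.mem_span_singleton]

/-- The map from the free module to `⨁ Λ / (p ^ m i)` sending the `i`-th basis vector to `p ^ d i`
times the generator of the `i`-th summand. -/
def cyclicSumMap (p : Λ) (d m : ι → ℕ) : (ι → Λ) →ₗ[Λ] CyclicSum p m :=
  Submodule.mkQ _ ∘ₗ LinearMap.pi fun i => p ^ d i • LinearMap.proj i

theorem cyclicSumMap_apply (p : Λ) (d m : ι → ℕ) (μ : ι → Λ) :
    cyclicSumMap p d m μ = Submodule.Quotient.mk fun i => p ^ d i * μ i := rfl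

theorem cyclicSumMap_eq_zero_iff {p : Λ} {d m : ι → ℕ} {μ : ι → Λ} :
    cyclicSumMap p d m μ = 0 ↔ ∀ i, p ^ m i ∣ p ^ d i * μ i :=
  CyclicSum.mk_eq_zero_iff

variable [IsLocalRing Λ] {V : Type u} [AddCommGroup V] [Module (ResidueField Λ) V] [Fintype ι]

/-- The semilinear map from the free `Λ`-module on a basis of a `k`-vector space `V` to `V`. -/
def residueCombination (e : Module.Basis ι (ResidueField Λ) V) : (ι → Λ) →ₛₗ[residue Λ] V where
  toFun μ := ∑ i, residue Λ (μ i) • e i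
  map_add' μ ν := by simp [add_smul, Finset.sum_add_distrib]
  map_smul' r μ := by simp [Finset.smul_sum, mul_smul]

theorem repr_residueCombination (e : Module.Basis ι (ResidueField Λ) V) (μ : ι → Λ) (i : ι) :
    e.repr (residueCombination e μ) i = residue Λ (μ i) :=
  e.repr_sum_self (fun i => residue Λ (μ i)) ▸ rfl

theorem residueCombination_surjective (e : Module.Basis ι (ResidueField Λ) V) :
    Function.Surjective (residueCombination e) := by
  intro v
  choose r hr using fun i => IsLocalRing.residue_surjective (e.repr v i)
  exact ⟨r, e.ext_elem fun i => by rw [repr_residueCombination, hr]⟩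

theorem residue_eq_zero_iff_dvd {p : Λ} (hp : maximalIdeal Λ = Ideal.span {p}) {c : Λ} :
    residue Λ c = 0 ↔ p ∣ c := by
  rw [IsLocalRing.residue_eq_zero_iff, hp, Ideal.mem_span_singleton]

theorem residueCombination_eq_zero_iff {p : Λ} (hp : maximalIdeal Λ = Ideal.span {p})
    (e : Module.Basis ι (ResidueField Λ) V) {μ : ι → Λ} :
    residueCombination e μ = 0 ↔ ∀ i, p ∣ μ i := by
  rw [e.ext_elem_iff]
  simp [repr_residueCombination, residue_eq_zero_iff_dvd hp]

end Realisation

namespace PosetRep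

variable {k : Type u} [Field k] {n : ℕ}

/-- The descending filtration of `V⁰` by the spaces `V^ℓ`, continued by zero from `ℓ = n` on. -/
def filtration (V : PosetRep k (ChainPoset n)) (ℓ : ℕ) : Submodule k V.V :=
  if ℓ < n then V.level ℓ else ⊥

theorem filtration_antitone (V : PosetRep k (ChainPoset n)) : Antitone V.filtration := by
  intro i j hij
  by_cases hj : j < n
  · have hi : i < n := hij.trans_lt hj
    rw [filtration, filtration, if_pos hj, if_pos hi]
    by_cases hi1 : 1 ≤ i
    · rw [level, level, dif_pos ⟨hi1.trans hij, hj⟩, dif_pos ⟨hi1, hi⟩]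
      exact V.mono (.chain _ _ _ _ _ _ hij)
    · rw [level, level, dif_neg fun h : 1 ≤ i ∧ i < n => hi1 h.1]
      exact le_top
  · rw [filtration, if_neg hj]
    exact bot_le

theorem filtration_zero (V : PosetRep k (ChainPoset n)) (hn : 0 < n) : V.filtration 0 = ⊤ := by
  simp [filtration, hn, level]

theorem filtration_length (V : PosetRep k (ChainPoset n)) : V.filtration n = ⊥ := by
  simp [filtration]

theorem filtration_chain (V : PosetRep k (ChainPoset n)) (ℓ : ℕ) (h₁ : 1 ≤ ℓ) (h₂ : ℓ < n) :
    V.filtration ℓ = V.sub (.chain ℓ h₁ h₂) := by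
  rw [filtration, if_pos h₂, level, dif_pos ⟨h₁, h₂⟩]

/-- The height of a nonzero vector in the filtration of `V⁰`. -/
theorem exists_height (V : PosetRep k (ChainPoset n)) (hn : 0 < n) {v : V.V} (hv : v ≠ 0) :
    ∃ d < n, ∀ j, v ∈ V.filtration j ↔ j ≤ d := by
  classical
  have hlt : ∀ j, v ∈ V.filtration j → j < n := fun j hj => by
    by_contra h
    rw [filtration, if_neg h, Submodule.mem_bot] at hj
    exact hv hj
  have h0 : v ∈ V.filtration 0 := by rw [V.filtration_zero hn]; exact Submodule.mem_top
  have hd := Nat.findGreatest_spec (P := fun j => v ∈ V.filtration j) (Nat.zero_le n) h0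
  exact ⟨_, hlt _ hd, fun j => ⟨fun hj => Nat.le_findGreatest (hlt j hj).le hj,
    fun hj => V.filtration_antitone hj hd⟩⟩

/-- Every object of `rep'_k P_n` is isomorphic to the representation of a pair in `S_2(Λ)`. -/
theorem exists_bounded_toRep_iso {Λ : Type u} [CommRing Λ] [IsLocalRing Λ]
    [IsUniserialOfLength Λ n] {p : Λ} (hp : maximalIdeal Λ = Ideal.span {p})
    (V : PosetRep (ResidueField Λ) (ChainPoset n)) (hV : isAdmissible (ResidueField Λ) n V) :
    ∃ X : SubPair Λ, SubPair.bounded p 2 X ∧ Nonempty (X.toRep n ≅ V) := by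
  classical
  have hn := length_pos n hp
  obtain ⟨ι, _, e, heF, heW⟩ := exists_basis_adapted V.filtration V.filtration_antitone
    (V.filtration_zero hn) V.filtration_length (V.sub .prime)
  choose d hdn hd using fun i => V.exists_height hn (e.ne_zero i)
  -- The element `p ^ d i` of the `i`-th summand is to be killed by `p` exactly if `e i ∈ V'`, and
  -- by `p ^ 2` in any case.
  let m : ι → ℕ := fun i => if e i ∈ V.sub .prime then d i + 1 else d i + 2
  have hm1 : ∀ i, e i ∈ V.sub .prime → m i = d i + 1 := fun i hi => if_pos hi
  have hm2 : ∀ i, e i ∉ V.sub .prime → m i = d i + 2 := fun i hi => if_neg hi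
  have hdm : ∀ i, d i < m i := fun i => by
    by_cases hi : e i ∈ V.sub .prime
    · rw [hm1 i hi]; omega
    · rw [hm2 i hi]; omega
  have hmd : ∀ i, m i ≤ d i + 2 := fun i => by
    by_cases hi : e i ∈ V.sub .prime
    · rw [hm1 i hi]; omega
    · rw [hm2 i hi]
  -- Since `V^{n-1} ⊆ V'`, a basis vector outside `V'` has height at most `n - 2`; this leaves room
  -- in `Λ` for a summand of length `d i + 2`.
  have hd2 : ∀ i, e i ∉ V.sub .prime → d i + 2 ≤ n := fun i hi => by
    by_contra h
    refine hi (hV.1 ?_)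
    have := (hd i (n - 1)).mpr (by omega)
    rwa [filtration, if_pos (by omega)] at this
  have hmn : ∀ i, m i ≤ n := fun i => by
    by_cases hi : e i ∈ V.sub .prime
    · rw [hm1 i hi]; exact hdn i
    · rw [hm2 i hi]; exact hd2 i hi
  have hpow : ∀ j < n, p ^ j ≠ 0 := fun j hj h =>
    absurd ((pow_eq_zero_iff_length_le n hp).mp h) (by omega)
  let φ := cyclicSumMap p d m
  let ψ := residueCombination e
  have hψ : Function.Surjective ψ := residueCombination_surjective e
  have hψ0 : ∀ {μ}, ψ μ = 0 ↔ ∀ i, p ∣ μ i := residueCombination_eq_zero_iff hp e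
  have hψF : ∀ {j μ}, ψ μ ∈ V.filtration j ↔ ∀ i, d i < j → p ∣ μ i := fun {j μ} => by
    rw [heF]
    refine forall_congr' fun i => ?_
    rw [hd, not_le, repr_residueCombination, residue_eq_zero_iff_dvd hp]
  have hψW : ∀ {μ}, ψ μ ∈ V.sub .prime ↔ ∀ i, e i ∉ V.sub .prime → p ∣ μ i := fun {μ} => by
    rw [heW]
    refine forall_congr' fun i => ?_
    rw [repr_residueCombination, residue_eq_zero_iff_dvd hp]
  have hφψ : ∀ {μ}, φ μ = 0 → ψ μ = 0 := fun {μ} h => hψ0.mpr fun i =>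
    dvd_of_pow_dvd_pow_mul hp (hdm i) (hpow _ (hdn i)) (cyclicSumMap_eq_zero_iff.mp h i)
  have hsoc : ∀ {μ}, φ μ ∈ soc Λ (CyclicSum p m) ↔ ψ μ ∈ V.sub .prime := fun {μ} => by
    rw [mem_soc_iff_smul_eq_zero hp, ← map_smul, cyclicSumMap_eq_zero_iff, hψW]
    refine forall_congr' fun i => ?_
    by_cases hi : e i ∈ V.sub .prime
    · simp only [hi, not_true_eq_false, false_imp_iff, iff_true, hm1 i hi]
      exact ⟨μ i, by simp only [Pi.smul_apply, smul_eq_mul]; ring⟩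
    · simp only [hi, not_false_eq_true, true_imp_iff, hm2 i hi]
      have hmul : p ^ d i * (p • μ) i = p ^ (d i + 1) * μ i := by
        simp only [Pi.smul_apply, smul_eq_mul]; ring
      rw [hmul]
      constructor
      · exact dvd_of_pow_dvd_pow_mul hp (by omega) (hpow _ (hd2 i hi))
      · rintro ⟨c, hc⟩
        exact ⟨c, by rw [hc]; ring⟩
  have hsocφ : soc Λ (CyclicSum p m) ≤ LinearMap.range φ := by
    intro x hx
    obtain ⟨x, rfl⟩ := Submodule.Quotient.mk_surjective _ x
    rw [mem_soc_iff_smul_eq_zero hp, ← Submodule.Quotient.mk_smul,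
      CyclicSum.mk_eq_zero_iff] at hx
    -- The socle of the `i`-th summand is generated by `p ^ (m i - 1)`, and `d i ≤ m i - 1`.
    have hdvd : ∀ i, p ^ d i ∣ x i := fun i => by
      have hmi : m i = m i - 1 + 1 := by have := hdm i; omega
      have h := hx i
      rw [hmi] at h
      have := hdm i
      have := hmn i
      exact (pow_dvd_pow p (by omega)).trans (pow_dvd_of_succ_dvd_mul n hp (by omega) h)
    choose μ hμ using hdvd
    exact ⟨μ, by rw [cyclicSumMap_apply]; exact congrArg _ (funext fun i => (hμ i).symm)⟩
  let X : SubPair Λ :=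
    { B := CyclicSum p m
      A := ((V.sub .dprime).comap ψ).map φ }
  have hA : ∀ {μ}, φ μ ∈ X.A ↔ ψ μ ∈ V.sub .dprime := fun {μ} => by
    constructor
    · rintro ⟨α, hα, h⟩
      have h0 : ψ (μ - α) = 0 := hφψ (by rw [map_sub, h, sub_self])
      rw [map_sub, sub_eq_zero] at h0
      rw [h0]
      exact hα
    · exact fun h => ⟨μ, h, rfl⟩
  -- The condition `V' + V'' = V⁰` is used here. The splitting makes `A⁺` the range of `φ` and, as
  -- `p` kills the socle, makes `A⁻` equal to `p` times that range.
  have hdecomp : ∀ μ, ∃ α σ, μ = α + σ ∧ φ α ∈ X.A ∧ φ σ ∈ soc Λ X.B := fun μ => by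
    have hμ : ψ μ ∈ V.sub .prime ⊔ V.sub .dprime := hV.2 ▸ Submodule.mem_top
    obtain ⟨w, hw, v, hv, hwv⟩ := Submodule.mem_sup.mp hμ
    obtain ⟨α, rfl⟩ := hψ v
    refine ⟨α, μ - α, by abel, hA.mpr hv, hsoc.mpr ?_⟩
    rw [map_sub, ← hwv, add_sub_cancel_right]
    exact hw
  have hplus : LinearMap.range φ = X.Aplus := by
    refine le_antisymm ?_ (sup_le ?_ hsocφ)
    · rintro _ ⟨μ, rfl⟩
      obtain ⟨α, σ, rfl, hα, hσ⟩ := hdecomp μ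
      rw [map_add]
      exact Submodule.add_mem _ (Submodule.mem_sup_left hα) (Submodule.mem_sup_right hσ)
    · rintro _ ⟨μ, -, rfl⟩
      exact ⟨μ, rfl⟩
  have hminus : ∀ μ, φ μ ∈ X.Aminus ↔ ψ μ = 0 := fun μ => by
    constructor
    · intro h
      obtain ⟨_, ⟨α, -, rfl⟩, hα⟩ := (mem_rad_iff hp).mp h
      have h0 : ψ (μ - p • α) = 0 := hφψ (by rw [map_sub, map_smul, hα, sub_self])
      have h1 : ψ (p • α) = 0 := hψ0.mpr fun i => ⟨α i, rfl⟩
      rwa [map_sub, h1, sub_zero] at h0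
    · intro h
      choose ν hν using hψ0.mp h
      obtain ⟨α, σ, hασ, hα, hσ⟩ := hdecomp ν
      refine (mem_rad_iff hp).mpr ⟨φ α, hα, ?_⟩
      have hμν : μ = p • ν := funext hν
      rw [hμν, hασ, map_smul, map_add, smul_add, (mem_soc_iff_smul_eq_zero hp).mp hσ, add_zero]
  have hbdd : SubPair.bounded p 2 X := by
    rintro _ ⟨α, -, rfl⟩
    rw [← map_smul]
    refine cyclicSumMap_eq_zero_iff.mpr fun i => (pow_dvd_pow p (hmd i)).trans ⟨α i, ?_⟩
    simp only [Pi.smul_apply, smul_eq_mul]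
    ring
  refine ⟨X, hbdd, SubPair.nonempty_toRep_iso φ ψ hψ hplus hminus fun i μ => ?_⟩
  have hμ : φ μ ∈ X.Aplus := hplus ▸ ⟨μ, rfl⟩
  cases i with
  | chain ℓ h₁ h₂ =>
    rw [← V.filtration_chain ℓ h₁ h₂]
    change φ μ ∈ radPow ℓ ⊤ ⊓ X.Aplus ⊔ X.Aminus ↔ _
    constructor
    · intro h
      obtain ⟨y, hy, z, hz, hyz⟩ := Submodule.mem_sup.mp h
      obtain ⟨κ, rfl⟩ : z ∈ LinearMap.range φ := hplus ▸ X.Aminus_le_Aplus hz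
      have hκ := (hminus κ).mp hz
      obtain ⟨b, -, hb⟩ := (mem_radPow_iff hp).mp hy.1
      obtain ⟨ν, rfl⟩ := Submodule.Quotient.mk_surjective _ b
      have hsub : φ (μ - κ) = p ^ ℓ • Submodule.Quotient.mk ν := by
        rw [map_sub, ← hyz, hb, add_sub_cancel_right]
      have hzero : (Submodule.Quotient.mk (fun i => p ^ d i * (μ - κ) i - p ^ ℓ * ν i) :
          CyclicSum p m) = 0 := sub_eq_zero.mpr hsub
      have hF : ψ (μ - κ) ∈ V.filtration ℓ := hψF.mpr fun i hi => by
        refine dvd_of_pow_dvd_pow_mul hp (Nat.lt_succ_self (d i)) (hpow _ (hdn i)) ?_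
        -- For `d i < ℓ`, both the modulus `p ^ m i` and the term from `rad^ℓ` are divisible by `p ^
        -- (d i + 1)`.
        have h1 := (pow_dvd_pow p (hdm i)).trans (CyclicSum.mk_eq_zero_iff.mp hzero i)
        have h2 : p ^ (d i + 1) ∣ p ^ ℓ * ν i := (pow_dvd_pow p hi).mul_right _
        exact (dvd_sub_left h2).mp h1
      rwa [map_sub, hκ, sub_zero] at hF
    · intro h
      rw [hψF] at h
      -- The coordinates of height below `ℓ` are divisible by `p` and contribute to `A⁻`; the others
      -- contribute to `rad^ℓ B`.
      let κ : ι → Λ := fun i => if d i < ℓ then μ i else 0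
      have hκ : φ κ ∈ X.Aminus := (hminus κ).mpr (hψ0.mpr fun i => by
        by_cases hi : d i < ℓ
        · simpa only [κ, if_pos hi] using h i hi
        · simp only [κ, if_neg hi, dvd_zero])
      have hrad : φ (μ - κ) ∈ radPow ℓ (⊤ : Submodule Λ X.B) := by
        -- Where `d i < ℓ` the exponent `d i - ℓ` is truncated to `0`, harmlessly, because `(μ - κ)
        -- i = 0` there.
        refine (mem_radPow_iff hp).mpr
          ⟨Submodule.Quotient.mk fun i => p ^ (d i - ℓ) * (μ - κ) i, Submodule.mem_top, ?_⟩
        rw [cyclicSumMap_apply, ← Submodule.Quotient.mk_smul]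
        refine congrArg _ (funext fun i => ?_)
        simp only [Pi.smul_apply, smul_eq_mul]
        by_cases hi : d i < ℓ
        · simp [κ, hi]
        · rw [← mul_assoc, ← pow_add, Nat.add_sub_cancel' (not_lt.mp hi)]
      have hμκ : φ μ = φ (μ - κ) + φ κ := by rw [← map_add, sub_add_cancel]
      rw [hμκ]
      exact Submodule.add_mem _ (Submodule.mem_sup_left ⟨hrad, hplus ▸ ⟨_, rfl⟩⟩)
        (Submodule.mem_sup_right hκ)
  | prime =>
    rw [← hsoc]
    exact (X.proj_mem_tilde_iff _ ⟨φ μ, hμ⟩).symm.trans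
      (SubPair.proj_mem_tilde_soc_iff hp hbdd _)
  | dprime =>
    rw [← hA]
    exact (X.proj_mem_tilde_iff _ ⟨φ μ, hμ⟩).symm.trans (SubPair.proj_mem_tilde_A_iff _)

end PosetRep

/-! ### The equivalence -/

section Equivalence

variable {Λ : Type u} [CommRing Λ] [IsLocalRing Λ] (n : ℕ) [IsUniserialOfLength Λ n] {p : Λ}

/-- Both conditions say that `f` maps `A⁺` into `C⁻`. -/
theorem functorF_map_eq_zero_iff {X Y : BoundedPair p 2} (f : X ⟶ Y) :
    (functorF n p).map f = 0 ↔ f ∈ idealN p X Y := by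
  constructor
  · rintro h _ ⟨x, hx, rfl⟩
    have h0 := LinearMap.congr_fun (congrArg PosetRep.linMap h) (X.obj.proj ⟨x, hx⟩)
    exact (SubPair.proj_eq_zero_iff Y.obj _).mp h0
  · intro h
    refine PosetRep.hom_ext (LinearMap.ext fun v => ?_)
    obtain ⟨x, rfl⟩ := X.obj.proj_surjective v
    exact (SubPair.proj_eq_zero_iff Y.obj _).mpr (h ⟨x, x.2, rfl⟩)

theorem SubPair.isAdmissible_toRep (hp : maximalIdeal Λ = Ideal.span {p}) (X : SubPair Λ) :
    PosetRep.isAdmissible (ResidueField Λ) n (X.toRep n) := by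
  have hn := length_pos n hp
  have hrad : radPow (n - 1) (⊤ : Submodule Λ X.B) ≤ soc Λ X.B := by
    intro x hx
    obtain ⟨b, -, rfl⟩ := (mem_radPow_iff hp).mp hx
    rw [mem_soc_iff_smul_eq_zero hp, smul_smul, ← pow_succ', Nat.sub_add_cancel hn,
      (pow_eq_zero_iff_length_le n hp).mpr le_rfl, zero_smul]
  refine ⟨?_, eq_top_iff.mpr fun v _ => ?_⟩
  · by_cases h : 1 ≤ n - 1 ∧ n - 1 < n
    · rw [PosetRep.level, dif_pos h]
      exact X.tilde_mono hrad
    -- This is the case `n = 1`: `V^{n-1}` is the total space, and `B` is its own socle.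
    · have h1 : n - 1 = 0 := by omega
      rw [h1, radPow_zero] at hrad
      intro v _
      obtain ⟨x, rfl⟩ := X.proj_surjective v
      exact X.proj_mem_tilde_of_mem (hrad Submodule.mem_top)
  · obtain ⟨⟨x, hx⟩, rfl⟩ := X.proj_surjective v
    obtain ⟨a, ha, s, hs, rfl⟩ := Submodule.mem_sup.mp hx
    have ha' : a ∈ X.Aplus := Submodule.mem_sup_left ha
    have hs' : s ∈ X.Aplus := Submodule.mem_sup_right hs
    have : X.proj ⟨a + s, hx⟩ = X.proj ⟨s, hs'⟩ + X.proj ⟨a, ha'⟩ := by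
      rw [← map_add]
      exact congrArg _ (Subtype.ext (add_comm a s))
    rw [this]
    exact Submodule.add_mem_sup (X.proj_mem_tilde_of_mem hs) (X.proj_mem_tilde_of_mem ha)

/-- The functor `F` as a functor to `rep'_k P_n`. -/
def functorFAdmissible (hp : maximalIdeal Λ = Ideal.span {p}) :
    BoundedPair p 2 ⥤ (PosetRep.isAdmissible (ResidueField Λ) n).FullSubcategory :=
  (PosetRep.isAdmissible (ResidueField Λ) n).lift (functorF n p)
    fun X => X.obj.isAdmissible_toRep n hp

/-- One direction lets `F` descend to the factor category, the other makes the induced functor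
faithful. -/
theorem functorFAdmissible_map_eq_iff (hp : maximalIdeal Λ = Ideal.span {p})
    {X Y : BoundedPair p 2} (f g : X ⟶ Y) :
    (functorFAdmissible n hp).map f = (functorFAdmissible n hp).map g ↔ relN p f g := by
  rw [relN, ← functorF_map_eq_zero_iff n, Functor.map_sub, sub_eq_zero]
  exact ⟨fun h => congrArg (PosetRep.isAdmissible (ResidueField Λ) n).ι.map h,
    fun h => (PosetRep.isAdmissible (ResidueField Λ) n).ι.map_injective h⟩

/-- The functor `S_2(Λ) / N ⥤ rep'_k P_n` induced by `F`. -/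
def functorFbar (hp : maximalIdeal Λ = Ideal.span {p}) :
    QuotientN p ⥤ (PosetRep.isAdmissible (ResidueField Λ) n).FullSubcategory :=
  CategoryTheory.Quotient.lift (relN p) (functorFAdmissible n hp)
    fun _ _ f g h => (functorFAdmissible_map_eq_iff n hp f g).mpr h

theorem functorFbar_additive (hp : maximalIdeal Λ = Ideal.span {p}) :
    (functorFbar n hp).Additive where
  map_add {X Y f g} := by
    obtain ⟨f, rfl⟩ := (Quotient.functor (relN p)).map_surjective f
    obtain ⟨g, rfl⟩ := (Quotient.functor (relN p)).map_surjective g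
    exact (PosetRep.isAdmissible (ResidueField Λ) n).ι.map_injective
      ((functorF n p).map_add (f := f) (g := g))

theorem functorFbar_isEquivalence (hp : maximalIdeal Λ = Ideal.span {p}) :
    (functorFbar n hp).IsEquivalence where
  faithful.map_injective {X Y} f g h := by
    obtain ⟨f, rfl⟩ := (Quotient.functor (relN p)).map_surjective f
    obtain ⟨g, rfl⟩ := (Quotient.functor (relN p)).map_surjective g
    exact CategoryTheory.Quotient.sound _ ((functorFAdmissible_map_eq_iff n hp f g).mp h)
  full.map_surjective {X Y} h := by
    obtain ⟨f, hf⟩ := SubPair.exists_map_eq n hp Y.as.property h.hom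
    exact ⟨(Quotient.functor (relN p)).map (ObjectProperty.homMk f),
      (PosetRep.isAdmissible (ResidueField Λ) n).ι.map_injective hf⟩
  essSurj.mem_essImage V := by
    obtain ⟨X, hX, ⟨i⟩⟩ := PosetRep.exists_bounded_toRep_iso hp V.obj V.property
    exact ⟨(Quotient.functor (relN p)).obj ⟨X, hX⟩,
      ⟨(PosetRep.isAdmissible (ResidueField Λ) n).ι.preimageIso i⟩⟩

end Equivalence

end

theorem mainTheorem1 (Λ : Type u) [CommRing Λ] [IsLocalRing Λ] (n : ℕ) [IsUniserialOfLength Λ n]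
    (p : Λ) (hp : maximalIdeal Λ = Ideal.span {p}) :
    (∀ (X Y : BoundedPair p 2) (f : X ⟶ Y), (functorF n p).map f = 0 ↔ f ∈ idealN p X Y) ∧
    ∃ Fbar : QuotientN p ⥤ (PosetRep.isAdmissible (ResidueField Λ) n).FullSubcategory,
      Quotient.functor (relN p) ⋙ Fbar ⋙ (PosetRep.isAdmissible (ResidueField Λ) n).ι = functorF n p ∧
      Fbar.Additive ∧ Fbar.IsEquivalence :=
  ⟨fun _ _ f => functorF_map_eq_zero_iff n f, functorFbar n hp, rfl, functorFbar_additive n hp,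
    functorFbar_isEquivalence n hp⟩
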